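/- For $\mathcal{E}>0$ consider the BPSK channel, whose two pure output states are the coherent states $|\sqrt{\mathcal E}\rangle$ and $|-\sqrt{\mathcal E}\rangle$ of a single bosonic mode, where $|\alpha\rangle=e^{-|\alpha|^2/2}\sum_{n\ge 0}\frac{\alpha^n}{\sqrt{n!}}|n\rangle$. For a block length $N$, let $C_{N,\mathsf{BPSK}}=C_{N,\mathsf{BPSK}}(\mathcal E)$ be the supremum of the mutual information $I(p_j,p_{k|j})$ (in nats) over all $M\ge 1$, all codes consisting of $M$ codewords of length $N$ over the two input symbols, all probability distributions $(p_j)$ on the $M$ messages, and all projective measurements with $M$ outcomes acting jointly on the $N$ received modes; here $p_{k|j}$ is the probability of outcome $k$ when the $j$-th codeword, a tensor product of $N$ coherent states, is received. Let $C_{\mathsf{BPSK}}(\mathcal E)=\max_{q\in[0,1]}\operatorname{Tr}(-\rho_q\log\rho_q)$ with $\rho_q=(1-q)|\sqrt{\mathcal E}\rangle\langle\sqrt{\mathcal E}|+q|-\sqrt{\mathcal E}\rangle\langle-\sqrt{\mathcal E}|$ be the capacity of the BPSK channel. All logarithms are natural, and $o(\mathcal E)$ refers to $\mathcal E\to 0^+$.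 Then the following hold. (1) Uniformly over the integers $N$ with $\mathcal E^{-1}(\log(1/\mathcal E))^2\le N\le \mathcal E^{-2}$, $$\frac{C_{N,\mathsf{BPSK}}}{N}\ \ge\ \mathcal E\log\frac1{\mathcal E}\left(1-\sqrt{\frac{\log\left(N\mathcal E\log(N\mathcal E)\right)}{N\mathcal E}}\right)+\mathcal E+o(\mathcal E).$$ (2) At $N=\mathcal E^{-1}(\log(1/\mathcal E))^2(\log\log(1/\mathcal E))^2$, rounded to an integer (up or down), $$\frac{C_{N,\mathsf{BPSK}}}{N}\ \ge\ \mathcal E\log\frac1{\mathcal E}+\mathcal E+o(\mathcal E).$$ (3) This matches the capacity to second order: $C_{\mathsf{BPSK}}(\mathcal E)=\mathcal E\log\frac1{\mathcal E}+\mathcal E+o(\mathcal E)$. -/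

import Mathlib

open Filter Topology Asymptotics

noncomputable section

namespace BPSK

/-- The Fock space of one bosonic mode, with the number states `|n⟩` as orthonormal basis. -/
abbrev Mode : Type := lp (fun _ : ℕ => ℂ) 2

/-- The `N`-fold Hilbert tensor power of the one-mode Fock space, written in its orthonormal basis
of product number states `|n₁⟩ ⊗ ⋯ ⊗ |n_N⟩`. -/
abbrev Modes (N : ℕ) : Type := lp (fun _ : Fin N → ℕ => ℂ) 2

/-- Number-state amplitudes `exp (-|α|² / 2) αⁿ / √(n!)` of the coherent state `|α⟩`. -/
def coherentAmplitude (α : ℂ) (n : ℕ) : ℂ :=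
  (Real.exp (-‖α‖ ^ 2 / 2) : ℂ) * α ^ n / (Real.sqrt (n.factorial : ℝ) : ℂ)

theorem norm_coherentAmplitude_sq (α : ℂ) (n : ℕ) :
    ‖coherentAmplitude α n‖ ^ 2 =
      Real.exp (-‖α‖ ^ 2 / 2) ^ 2 * ((‖α‖ ^ 2) ^ n / (n.factorial : ℝ)) := by
  have h : (0 : ℝ) ≤ (n.factorial : ℝ) := Nat.cast_nonneg _
  simp only [coherentAmplitude, norm_div, norm_mul, norm_pow, Complex.norm_real, Real.norm_eq_abs]
  rw [div_pow, mul_pow, sq_abs, sq_abs, Real.sq_sqrt h]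
  ring

theorem coherentAmplitude_mem (α : ℂ) : Memℓp (coherentAmplitude α) 2 := by
  refine (memℓp_gen_iff (by norm_num)).2 ?_
  have h := (Real.summable_pow_div_factorial (‖α‖ ^ 2)).mul_left (Real.exp (-‖α‖ ^ 2 / 2) ^ 2)
  refine h.congr fun n => ?_
  rw [← norm_coherentAmplitude_sq]
  norm_num

/-- The coherent state `|α⟩` of complex amplitude `α`. -/
def coherentState (α : ℂ) : Mode := ⟨coherentAmplitude α, coherentAmplitude_mem α⟩

theorem tensor_mem {N : ℕ} (ψ : Fin N → Mode) :
    Memℓp (fun n : Fin N → ℕ => ∏ i, ψ i (n i)) 2 := by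
  have hs : ∀ i, Summable fun m : ℕ => ‖ψ i m‖ ^ 2 := fun i => by
    have h := (memℓp_gen_iff (p := 2) (by norm_num)).1 (lp.memℓp (ψ i))
    exact h.congr fun m => by norm_num
  refine memℓp_gen' (C := ∏ i, ∑' m : ℕ, ‖ψ i m‖ ^ 2) fun s => ?_
  have h1 : s ⊆ Fintype.piFinset fun i => s.image fun n => n i := fun n hn => by
    simp only [Fintype.mem_piFinset, Finset.mem_image]
    exact fun i => ⟨n, hn, rfl⟩
  calc ∑ n ∈ s, ‖∏ i, ψ i (n i)‖ ^ (2 : ENNReal).toReal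
      = ∑ n ∈ s, ∏ i, ‖ψ i (n i)‖ ^ 2 := by
        refine Finset.sum_congr rfl fun n _ => ?_
        have h : ‖∏ i, ψ i (n i)‖ = ∏ i, ‖ψ i (n i)‖ := norm_prod _ _
        rw [h, ENNReal.toReal_ofNat, Real.rpow_ofNat]
        exact (Finset.prod_pow _ _ _).symm
    _ ≤ ∑ n ∈ Fintype.piFinset fun i => s.image fun n => n i, ∏ i, ‖ψ i (n i)‖ ^ 2 :=
        Finset.sum_le_sum_of_subset_of_nonneg h1 fun n _ _ =>
          Finset.prod_nonneg fun i _ => sq_nonneg _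
    _ = ∏ i, ∑ m ∈ s.image (fun n => n i), ‖ψ i m‖ ^ 2 :=
        (Finset.prod_univ_sum (fun i => s.image fun n => n i) fun i m => ‖ψ i m‖ ^ 2).symm
    _ ≤ ∏ i, ∑' m : ℕ, ‖ψ i m‖ ^ 2 :=
        Finset.prod_le_prod (fun i _ => Finset.sum_nonneg fun m _ => sq_nonneg _) fun i _ =>
          (hs i).sum_le_tsum _ fun m _ => sq_nonneg _

/-- The product state `ψ₁ ⊗ ⋯ ⊗ ψ_N`. -/
def tensorState {N : ℕ} (ψ : Fin N → Mode) : Modes N :=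
  ⟨fun n => ∏ i, ψ i (n i), tensor_mem ψ⟩

/-- A projective measurement with outcomes `0, …, M - 1`: orthogonal projections that resolve the
identity (and hence have mutually orthogonal ranges). A measurement in an orthonormal basis whose
outcome is afterwards mapped to one of `M` messages is of this form, and conversely. -/
structure ProjectiveMeasurement (H : Type*) [NormedAddCommGroup H] [InnerProductSpace ℂ H]
    [CompleteSpace H] (M : ℕ) where
  proj : Fin M → H →L[ℂ] H
  isProj : ∀ k, IsStarProjection (proj k)
  resolution : ∑ k, proj k = 1

/-- Born rule: the probability of outcome `k` on the pure state `φ`. -/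
def ProjectiveMeasurement.prob {H : Type*} [NormedAddCommGroup H] [InnerProductSpace ℂ H]
    [CompleteSpace H] {M : ℕ} (P : ProjectiveMeasurement H M) (φ : H) (k : Fin M) : ℝ :=
  ‖P.proj k φ‖ ^ 2

/-- Mutual information, in nats, between the input and the output of the channel with transition
probabilities `W j k` under the input distribution `p`. -/
def mutualInfo {M : ℕ} (p : Fin M → ℝ) (W : Fin M → Fin M → ℝ) : ℝ :=
  ∑ j, ∑ k, p j * W j k * Real.log (W j k / ∑ i, p i * W i k)

/-- Transition probabilities of the superchannel formed by the inner code `c` (`M` codewords of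
length `N`), the channel `x ↦ |ψ x⟩` and a joint measurement of the `N` received modes. -/
def superchannel {X : Type*} (ψ : X → Mode) {N M : ℕ} (c : Fin M → Fin N → X)
    (P : ProjectiveMeasurement (Modes N) M) (j k : Fin M) : ℝ :=
  P.prob (tensorState fun i => ψ (c j i)) k

/-- `C_N`: the largest mutual information of a superchannel, over all input distributions, all
inner codes of length `N` with any number `M` of codewords, and all joint measurements of the `N`
modes whose outcome is an estimate of the message. -/
def blockCapacity {X : Type*} (ψ : X → Mode) (N : ℕ) : ℝ :=
  sSup {I : ℝ | ∃ (M : ℕ) (c : Fin M → Fin N → X) (P : ProjectiveMeasurement (Modes N) M),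
    ∃ p ∈ stdSimplex ℝ (Fin M), I = mutualInfo p (superchannel ψ c P)}

/-- The average state `∑ x, p x |ψ x⟩⟨ψ x|`. -/
def densityOperator {H X : Type*} [NormedAddCommGroup H] [InnerProductSpace ℂ H] [Fintype X]
    (ψ : X → H) (p : X → ℝ) : H →L[ℂ] H :=
  ∑ x, (p x : ℂ) • InnerProductSpace.rankOne ℂ (ψ x) (ψ x)

/-- Von Neumann entropy `Tr (-ρ log ρ)`, in nats: the operator comes from the continuous functional
calculus and its trace is taken in the orthonormal basis `b`. -/
def vonNeumannEntropy {H ι : Type*} [NormedAddCommGroup H] [InnerProductSpace ℂ H]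
    [CompleteSpace H] (b : HilbertBasis ι ℂ H) (ρ : H →L[ℂ] H) : ℝ :=
  ∑' i, (inner ℂ (b i) (cfc Real.negMulLog ρ (b i))).re

/-- The number states as an orthonormal basis of the one-mode Fock space. -/
def numberBasis : HilbertBasis ℕ ℂ Mode := HilbertBasis.ofRepr (LinearIsometryEquiv.refl ℂ Mode)

/-- The capacity `max_p S(ρ)` of the pure-state channel `x ↦ |ψ x⟩`. -/
def capacity {X : Type*} [Fintype X] (ψ : X → Mode) : ℝ :=
  sSup ((fun p : X → ℝ => vonNeumannEntropy numberBasis (densityOperator ψ p)) '' stdSimplex ℝ X)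

/-- The BPSK constellation of mean photon number `E`: the coherent states `|√E⟩` and `|-√E⟩`. -/
def bpsk (E : ℝ) (x : Bool) : Mode :=
  coherentState (if x then (Real.sqrt E : ℂ) else -(Real.sqrt E : ℂ))

end BPSK

end

noncomputable section

namespace BPSK

/-! ### Measurements and mutual information -/

/-! In the number basis, a product of states `|±√E⟩` differs from `|√E⟩ ⊗ ⋯ ⊗ |√E⟩` only by the sign
`(-1)^(x · S)`, where `S` is the vector of photon-number parities. These parities are independent,
each odd with probability `lam E 1 = (1 - exp (-2E)) / 2`.

Take the linear code whose codeword for message `y` is the transpose of a linear map `h` applied to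
`y`. The sign becomes `(-1)^(y · h S)`, so the codeword is a superposition, with character signs, of
orthonormal vectors `f b` with weights `√(w b)`, `w` being the law of `h S`. Measuring in the
Fourier basis of the `f b` succeeds with probability `(∑ b, √(w b / 2^k))²`, the squared fidelity of
`w` with the uniform law. Decoding is thereby reduced to privacy amplification: a 2-universal linear
hash must make the parities nearly uniform (`exists_hash_fidelity_ge`, `exists_linear_hash`), with
error `2^(ks) (∑ a, lam E a ^ (1+s))^N`.

With `L = log (1/E)`, the choice `s = δ / L` and rate `E L (1 - δ) + E` give an error of order `exp
(-N E δ² / 2)` (`blockCapacity_ge_rate`); the `δ` of the theorem makes this small compared with `1 /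
L`. For the capacity, the equal mixture is optimal and has eigenvalues `(1 ± exp (-2E)) / 2`, so the
capacity is a binary entropy and can be expanded. -/

theorem ProjectiveMeasurement.sum_prob {H : Type*} [NormedAddCommGroup H] [InnerProductSpace ℂ H]
    [CompleteSpace H] {M : ℕ} (P : ProjectiveMeasurement H M) (φ : H) :
    ∑ k, P.prob φ k = ‖φ‖ ^ 2 := by
  have h : ∀ k, (P.prob φ k : ℂ) = inner ℂ φ (P.proj k φ) := fun k => by
    have h1 : P.proj k (P.proj k φ) = P.proj k φ :=
      congrArg (fun T : H →L[ℂ] H => T φ) (P.isProj k).isIdempotentElem.eq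
    have h2 := ContinuousLinearMap.adjoint_inner_right (P.proj k) φ (P.proj k φ)
    rw [← ContinuousLinearMap.star_eq_adjoint, (P.isProj k).isSelfAdjoint.star_eq, h1] at h2
    rw [h2, inner_self_eq_norm_sq_to_K, ProjectiveMeasurement.prob]
    push_cast
    rfl
  have h3 : (∑ k, (P.prob φ k : ℂ)) = ((‖φ‖ ^ 2 : ℝ) : ℂ) := by
    simp_rw [h]
    rw [← inner_sum, ← sum_apply, P.resolution,
      one_apply_eq_self, inner_self_eq_norm_sq_to_K]
    push_cast
    rfl
  exact_mod_cast h3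

/-- The orthonormal family need not span, so the projection onto its complement is merged into
outcome 0. It annihilates states in the span and leaves their statistics unchanged. -/
theorem exists_measurement_of_orthonormal {H : Type*} [NormedAddCommGroup H]
    [InnerProductSpace ℂ H] [CompleteSpace H] {M : ℕ} (hM : 0 < M) (e : Fin M → H)
    (he : Orthonormal ℂ e) :
    ∃ P : ProjectiveMeasurement H M, ∀ φ, ∑ k, inner ℂ (e k) φ • e k = φ →
      ∀ k, P.prob φ k = ‖inner ℂ (e k) φ‖ ^ 2 := by
  classical
  set R : Fin M → H →L[ℂ] H := fun k => InnerProductSpace.rankOne ℂ (e k) (e k) with hR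
  have hRap : ∀ k φ, R k φ = inner ℂ (e k) φ • e k := fun k φ => rfl
  have hRp : ∀ k, IsStarProjection (R k) := fun k =>
    InnerProductSpace.isStarProjection_rankOne_self (he.1 k)
  have hRR : ∀ i k, R i * R k = if i = k then R k else 0 := fun i k => by
    ext φ
    rw [mul_apply_eq_comp, hRap, hRap, inner_smul_right, orthonormal_iff_ite.1 he]
    split_ifs with h
    · subst h; simp [hRap]
    · simp
  set T := ∑ k, R k with hT
  have hTR : ∀ k, T * R k = R k := fun k => by simp [hT, Finset.sum_mul, hRR]
  have hRT : ∀ k, R k * T = R k := fun k => by simp [hT, Finset.mul_sum, hRR]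
  have hTT : T * T = T := by
    conv_lhs => rw [hT, Finset.mul_sum]
    exact Finset.sum_congr rfl fun k _ => hTR k
  have hTp : IsStarProjection T := by
    refine ⟨hTT, ?_⟩
    rw [hT]
    exact isSelfAdjoint_sum _ fun k _ => (hRp k).isSelfAdjoint
  have h1T := hTp.one_sub
  let z : Fin M := ⟨0, hM⟩
  refine ⟨⟨fun k => R k + if k = z then 1 - T else 0, fun k => ?_, ?_⟩, fun φ hφ k => ?_⟩
  · by_cases hk : k = z
    · simp only [hk, if_true]
      refine ⟨?_, (hRp z).isSelfAdjoint.add h1T.isSelfAdjoint⟩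
      have h0 := (hRp z).isIdempotentElem.eq
      have h1 := h1T.isIdempotentElem.eq
      rw [IsIdempotentElem, mul_add, add_mul, add_mul, h0, h1, mul_sub, sub_mul, hTR, hRT]
      simp
    · simpa only [hk, if_false, add_zero] using hRp k
  · rw [Finset.sum_add_distrib, Finset.sum_ite_eq' Finset.univ z]
    simp [hT]
  · have hTφ : T φ = φ := by
      rw [hT, sum_apply]
      exact hφ
    have : (R k + if k = z then 1 - T else 0) φ = inner ℂ (e k) φ • e k := by
      split_ifs
      · simp [hTφ, hRap]
      · simp [hRap]
    simp only [ProjectiveMeasurement.prob]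
    rw [this, norm_smul, he.1 k, mul_one]

/-- A doubly stochastic channel keeps the output uniform, so the logarithms have the form `log (M
W)`. From `x log x ≥ x - 1`, each term is at least `-1/M`, and a diagonal one at least `(1 - ε) log
M - 1`; these two losses add up to the constant 2 in every row. -/
theorem mutualInfo_uniform_ge {M : ℕ} (hM : 0 < M) (W : Fin M → Fin M → ℝ)
    (h0 : ∀ j k, 0 ≤ W j k) (hcol : ∀ k, ∑ j, W j k = 1) (ε : ℝ) (hε : ∀ j, 1 - ε ≤ W j j) :
    (1 - ε) * Real.log M - 2 ≤ mutualInfo (fun _ => (M : ℝ)⁻¹) W := by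
  have hM' : (0 : ℝ) < M := Nat.cast_pos.2 hM
  have hlogM : 0 ≤ Real.log M := Real.log_natCast_nonneg M
  have hxlog : ∀ x : ℝ, 0 ≤ x → x - 1 ≤ x * Real.log x := fun x hx => by
    rcases hx.eq_or_lt with rfl | hx
    · simp
    · have h := Real.one_sub_inv_le_log_of_pos hx
      have h2 := mul_le_mul_of_nonneg_left h hx.le
      rwa [mul_sub, mul_one, mul_inv_cancel₀ hx.ne'] at h2
  have hterm : ∀ j k, (if k = j then (1 - ε) * Real.log M - 1 else 0) - (M : ℝ)⁻¹ ≤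
      W j k * Real.log (M * W j k) := fun j k => by
    split_ifs with hk
    · subst hk
      have h1 : W k k * Real.log (M * W k k) =
          W k k * Real.log M + W k k * Real.log (W k k) := by
        rcases (h0 k k).eq_or_lt with h | h
        · simp [← h]
        · rw [Real.log_mul hM'.ne' h.ne', mul_add]
      have h2 := hxlog _ (h0 k k)
      have h3 := mul_le_mul_of_nonneg_right (hε k) hlogM
      have h4 := h0 k k
      have h5 : 0 < (M : ℝ)⁻¹ := inv_pos.2 hM'
      rw [h1]
      linarith
    · have h := hxlog (M * W j k) (mul_nonneg hM'.le (h0 j k))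
      have h1 : W j k * Real.log (M * W j k) =
          (M : ℝ)⁻¹ * (M * W j k * Real.log (M * W j k)) := by
        field_simp
      have h2 := mul_le_mul_of_nonneg_left h (inv_pos.2 hM').le
      have h3 : (M : ℝ)⁻¹ * (M * W j k - 1) = W j k - (M : ℝ)⁻¹ := by field_simp
      rw [h3] at h2
      linarith [h0 j k]
  have hrow : ∀ j, (1 - ε) * Real.log M - 2 ≤ ∑ k, W j k * Real.log (M * W j k) := fun j => by
    calc (1 - ε) * Real.log M - 2
        = ∑ k, ((if k = j then (1 - ε) * Real.log M - 1 else 0) - (M : ℝ)⁻¹) := by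
          rw [Finset.sum_sub_distrib, Finset.sum_ite_eq' Finset.univ j]
          simp [hM'.ne']
          ring
      _ ≤ _ := Finset.sum_le_sum fun k _ => hterm j k
  calc (1 - ε) * Real.log M - 2
      = ∑ _j : Fin M, (M : ℝ)⁻¹ * ((1 - ε) * Real.log M - 2) := by
        simp only [Finset.sum_const, Finset.card_univ, Fintype.card_fin, nsmul_eq_mul]
        field_simp
    _ ≤ ∑ j, (M : ℝ)⁻¹ * ∑ k, W j k * Real.log (M * W j k) :=
        Finset.sum_le_sum fun j _ => mul_le_mul_of_nonneg_left (hrow j) (inv_pos.2 hM').le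
    _ = mutualInfo (fun _ => (M : ℝ)⁻¹) W := by
        simp only [mutualInfo, Finset.mul_sum]
        refine Finset.sum_congr rfl fun j _ => Finset.sum_congr rfl fun k _ => ?_
        rw [← Finset.mul_sum, hcol, mul_one, div_inv_eq_mul, mul_comm (W j k) (M : ℝ), mul_assoc]

/-- A crude bound that does not depend on `M`: the output law dominates `Q (c j) * V (c j) k`, with
`Q` the input mass of a codeword, so each logarithm is at most `1 / Q (c j)`. Grouping messages by
codeword gives at most 1 per element of `X`. -/
theorem mutualInfo_le_card {X : Type*} [Fintype X] {M : ℕ} (c : Fin M → X) (V : X → Fin M → ℝ)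
    (h0 : ∀ x k, 0 ≤ V x k) (hrow : ∀ x, ∑ k, V x k = 1) (p : Fin M → ℝ)
    (hp : p ∈ stdSimplex ℝ (Fin M)) :
    mutualInfo p (fun j k => V (c j) k) ≤ Fintype.card X := by
  classical
  set Q : X → ℝ := fun x => ∑ i with c i = x, p i with hQ
  have hQ0 : ∀ x, 0 ≤ Q x := fun x => Finset.sum_nonneg fun i _ => hp.1 i
  have hpQ : ∀ j, p j ≤ Q (c j) := fun j =>
    Finset.single_le_sum (f := p) (fun i _ => hp.1 i) (by simp)
  have hterm : ∀ j k, p j * V (c j) k * Real.log (V (c j) k / ∑ i, p i * V (c i) k) ≤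
      p j / Q (c j) * V (c j) k := fun j k => by
    rcases (hp.1 j).eq_or_lt with hj | hj
    · simp [← hj]
    rcases (h0 (c j) k).eq_or_lt with hk | hk
    · simp [← hk]
    have hQj : 0 < Q (c j) := hj.trans_le (hpQ j)
    have h1 : Q (c j) * V (c j) k ≤ ∑ i, p i * V (c i) k := by
      rw [hQ, Finset.sum_mul]
      calc ∑ i with c i = c j, p i * V (c j) k = ∑ i with c i = c j, p i * V (c i) k :=
            Finset.sum_congr rfl fun i hi => by rw [(Finset.mem_filter.1 hi).2]
        _ ≤ _ := Finset.sum_le_sum_of_subset_of_nonneg (Finset.filter_subset _ _)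
            fun i _ _ => mul_nonneg (hp.1 i) (h0 _ _)
    have h2 : 0 < Q (c j) * V (c j) k := mul_pos hQj hk
    have h3 : Real.log (V (c j) k / ∑ i, p i * V (c i) k) ≤ (Q (c j))⁻¹ := by
      refine (Real.log_le_self (div_nonneg hk.le (h2.le.trans h1))).trans ?_
      rw [div_le_iff₀ (h2.trans_le h1), inv_mul_eq_div, le_div_iff₀ hQj]
      linarith
    calc _ ≤ p j * V (c j) k * (Q (c j))⁻¹ :=
          mul_le_mul_of_nonneg_left h3 (mul_pos hj hk).le
      _ = _ := by ring
  calc mutualInfo p (fun j k => V (c j) k)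
      ≤ ∑ j, ∑ k, p j / Q (c j) * V (c j) k :=
        Finset.sum_le_sum fun j _ => Finset.sum_le_sum fun k _ => hterm j k
    _ = ∑ j, p j / Q (c j) := by simp_rw [← Finset.mul_sum, hrow, mul_one]
    _ = ∑ x, ∑ j with c j = x, p j / Q (c j) := (Finset.sum_fiberwise _ _ _).symm
    _ = ∑ x, Q x / Q x := by
        refine Finset.sum_congr rfl fun x _ => ?_
        rw [hQ, Finset.sum_div]
        exact Finset.sum_congr rfl fun i hi => by rw [(Finset.mem_filter.1 hi).2]
    _ ≤ ∑ _x : X, (1 : ℝ) := Finset.sum_le_sum fun x _ => div_self_le_one _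
    _ = Fintype.card X := by simp

/-! ### Random hashing -/

/-- The parabola touches the square root at `u = 1`. It bounds a fidelity with the uniform law below
by total mass and collision probability, which can be averaged over the hash. -/
theorem sqrt_ge_quadratic {u : ℝ} (hu : 0 ≤ u) : 3 / 2 * u - u ^ 2 / 2 ≤ √u := by
  obtain ⟨t, ht, rfl⟩ : ∃ t, 0 ≤ t ∧ u = t ^ 2 := ⟨√u, Real.sqrt_nonneg u, (Real.sq_sqrt hu).symm⟩
  rw [Real.sqrt_sq ht]
  have h : 0 ≤ t * (t - 1) ^ 2 * (t + 2) := by positivity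
  nlinarith [h]

/-- One-shot privacy amplification: a hash function from a 2-universal family sends `p` close to
the uniform distribution, in fidelity. -/
theorem exists_hash_fidelity_ge {α β τ : Type*} [Fintype α] [Fintype β] [DecidableEq α]
    [DecidableEq β] (Ω : Finset τ) (hΩ : Ω.Nonempty) (h : τ → α → β) (M : ℝ) (hM : 0 < M)
    (huniv : ∀ x y, x ≠ y → M * (Ω.filter fun t => h t x = h t y).card ≤ Ω.card)
    (p : α → ℝ) (hp : ∀ x, 0 ≤ p x) (hp1 : ∑ x, p x = 1) (s : ℝ) (hs0 : 0 ≤ s) (hs1 : s ≤ 1) :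
    ∃ t ∈ Ω, 1 - M ^ s * ∑ x, p x ^ (1 + s) ≤
      ∑ b, √((∑ x, if h t x = b then p x else 0) / M) := by
  -- Atoms heavier than `1/M` cannot be flattened and would spoil the second moment, so they are
  -- discarded; the lost mass `1 - Q` is part of the error.
  set q : α → ℝ := fun x => if p x ≤ M⁻¹ then p x else 0 with hq
  have hq0 : ∀ x, 0 ≤ q x := fun x => by
    simp only [hq]; split_ifs
    exacts [hp x, le_rfl]
  have hqp : ∀ x, q x ≤ p x := fun x => by
    simp only [hq]; split_ifs
    exacts [le_rfl, hp x]
  set Q := ∑ x, q x with hQ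
  have hQ0 : 0 ≤ Q := Finset.sum_nonneg fun x _ => hq0 x
  have hQ1 : Q ≤ 1 := hp1 ▸ Finset.sum_le_sum fun x _ => hqp x
  -- The right side is `p (M p)^s`. For light atoms `M p ≤ (M p)^s` since `s ≤ 1`; for heavy ones `1
  -- ≤ (M p)^s` since `0 ≤ s`.
  have hpoint : ∀ x, p x - q x + M / 2 * q x ^ 2 ≤ M ^ s * p x ^ (1 + s) := fun x => by
    rcases (hp x).eq_or_lt with h0 | h0
    · have : q x = 0 := le_antisymm (h0 ▸ hqp x) (hq0 x)
      rw [this, ← h0]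
      have : 0 ≤ M ^ s * (0 : ℝ) ^ (1 + s) := by positivity
      simpa using this
    have hE : M ^ s * p x ^ (1 + s) = p x * (M * p x) ^ s := by
      rw [Real.rpow_add h0, Real.rpow_one, Real.mul_rpow hM.le h0.le]; ring
    rw [hE]
    by_cases hx : p x ≤ M⁻¹
    · have hMp : M * p x ≤ 1 := by
        have := mul_le_mul_of_nonneg_left hx hM.le
        rwa [mul_inv_cancel₀ hM.ne'] at this
      have h1 : M * p x ≤ (M * p x) ^ s := by
        have := Real.rpow_le_rpow_of_exponent_ge (mul_pos hM h0) hMp hs1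
        rwa [Real.rpow_one] at this
      simp only [hq, hx, if_true]
      have h2 := mul_le_mul_of_nonneg_left h1 h0.le
      have h3 : 0 ≤ M * p x ^ 2 := by positivity
      nlinarith
    · have hMp : 1 ≤ M * p x := by
        have := mul_le_mul_of_nonneg_left (not_le.1 hx).le hM.le
        rwa [mul_inv_cancel₀ hM.ne'] at this
      have h1 := Real.one_le_rpow hMp hs0
      simp only [hq, hx, if_false]
      nlinarith
  have hfid : ∀ t, 3 / 2 * Q - M / 2 * ∑ x, ∑ y, (if h t x = h t y then q x * q y else 0) ≤
      ∑ b, √((∑ x, if h t x = b then p x else 0) / M) := fun t => by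
    have hsum : ∑ b, (∑ x, if h t x = b then q x else 0) = Q := by
      rw [Finset.sum_comm]; simp [hQ]
    have hsq : ∑ b, (∑ x, if h t x = b then q x else 0) ^ 2 =
        ∑ x, ∑ y, (if h t x = h t y then q x * q y else 0) := by
      simp_rw [sq, Finset.sum_mul_sum]
      rw [Finset.sum_comm]
      refine Finset.sum_congr rfl fun x _ => ?_
      rw [Finset.sum_comm]
      refine Finset.sum_congr rfl fun y _ => ?_
      simp_rw [ite_zero_mul_ite_zero]
      by_cases hxy : h t x = h t y
      · simp [hxy]
      · have : ∀ b, ¬ (h t x = b ∧ h t y = b) := fun b hb => hxy (hb.1.trans hb.2.symm)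
        simp [this, hxy]
    rw [← hsq, ← hsum, Finset.mul_sum, Finset.mul_sum, ← Finset.sum_sub_distrib]
    refine Finset.sum_le_sum fun b _ => ?_
    set w := ∑ x, if h t x = b then q x else 0 with hw
    have hw0 : 0 ≤ w := Finset.sum_nonneg fun x _ => by
      split_ifs
      exacts [hq0 x, le_rfl]
    have hww : w ≤ ∑ x, if h t x = b then p x else 0 := Finset.sum_le_sum fun x _ => by
      split_ifs
      exacts [hqp x, le_rfl]
    have h1 := sqrt_ge_quadratic (mul_nonneg hM.le hw0)
    have h2 : √(w / M) = √(M * w) / M := by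
      rw [← Real.sqrt_sq hM.le, ← Real.sqrt_div' _ (sq_nonneg M), Real.sqrt_sq hM.le]
      congr 1
      field_simp
    calc 3 / 2 * w - M / 2 * w ^ 2 = (3 / 2 * (M * w) - (M * w) ^ 2 / 2) / M := by field_simp
      _ ≤ √(M * w) / M := div_le_div_of_nonneg_right h1 hM.le
      _ = √(w / M) := h2.symm
      _ ≤ _ := Real.sqrt_le_sqrt (div_le_div_of_nonneg_right hww hM.le)
  -- Distinct points collide for at most a fraction `1/M` of the hashes; the diagonal always
  -- collides.
  have hcoll : M * ∑ t ∈ Ω, ∑ x, ∑ y, (if h t x = h t y then q x * q y else 0) ≤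
      Ω.card * (Q ^ 2 + M * ∑ x, q x ^ 2) := by
    have h1 : ∀ x y, M * ∑ t ∈ Ω, (if h t x = h t y then q x * q y else 0) ≤
        Ω.card * (q x * q y + if x = y then M * q x ^ 2 else 0) := fun x y => by
      rw [← Finset.sum_filter, Finset.sum_const, nsmul_eq_mul]
      split_ifs with hxy
      · subst hxy
        have : 0 ≤ q x * q x := mul_self_nonneg _
        simp only [Finset.filter_true]
        nlinarith [Nat.cast_nonneg (α := ℝ) Ω.card]
      · have := mul_le_mul_of_nonneg_right (huniv x y hxy) (mul_nonneg (hq0 x) (hq0 y))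
        linarith
    calc _ = ∑ x, ∑ y, M * ∑ t ∈ Ω, (if h t x = h t y then q x * q y else 0) := by
          rw [Finset.sum_comm]
          simp_rw [Finset.mul_sum]
          refine Finset.sum_congr rfl fun x _ => ?_
          rw [Finset.sum_comm]
      _ ≤ ∑ x, ∑ y, Ω.card * (q x * q y + if x = y then M * q x ^ 2 else 0) :=
          Finset.sum_le_sum fun x _ => Finset.sum_le_sum fun y _ => h1 x y
      _ = _ := by
          simp_rw [← Finset.mul_sum, Finset.sum_add_distrib, ← Finset.mul_sum]
          rw [← Finset.sum_mul, sq, Finset.mul_sum]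
          simp [← Finset.mul_sum]
  refine Finset.exists_le_of_sum_le hΩ ?_
  have hcard : (0 : ℝ) ≤ Ω.card := Nat.cast_nonneg _
  have hS : 1 - M ^ s * ∑ x, p x ^ (1 + s) ≤ Q - M / 2 * ∑ x, q x ^ 2 := by
    have := Finset.sum_le_sum fun x (_ : x ∈ Finset.univ) => hpoint x
    rw [Finset.sum_add_distrib, Finset.sum_sub_distrib, ← Finset.mul_sum, ← Finset.mul_sum,
      hp1] at this
    linarith
  calc ∑ _t ∈ Ω, (1 - M ^ s * ∑ x, p x ^ (1 + s))
      ≤ Ω.card * (3 / 2 * Q - (Q ^ 2 + M * ∑ x, q x ^ 2) / 2) := by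
        rw [Finset.sum_const, nsmul_eq_mul]
        refine mul_le_mul_of_nonneg_left (hS.trans ?_) hcard
        nlinarith
    _ ≤ ∑ t ∈ Ω,
        (3 / 2 * Q - M / 2 * ∑ x, ∑ y, (if h t x = h t y then q x * q y else 0)) := by
        rw [Finset.sum_sub_distrib, Finset.sum_const, nsmul_eq_mul, ← Finset.mul_sum]
        linarith
    _ ≤ _ := Finset.sum_le_sum fun t _ => hfid t

/-- The family is `x ↦ π (t x)`, with `x` read in the field with `2^N` elements, `t ≠ 0`, and `π`
keeping `k` coordinates. Excluding `t = 0` makes every member surjective, so that later no hash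
class has zero weight. -/
theorem exists_linear_hash {N k : ℕ} (hN : N ≠ 0) (hk : k ≤ N) (p : (Fin N → ZMod 2) → ℝ)
    (hp : ∀ x, 0 ≤ p x) (hp1 : ∑ x, p x = 1) (s : ℝ) (hs0 : 0 ≤ s) (hs1 : s ≤ 1) :
    ∃ h : (Fin N → ZMod 2) →ₗ[ZMod 2] (Fin k → ZMod 2), Function.Surjective h ∧
      1 - ((2 : ℝ) ^ k) ^ s * ∑ x, p x ^ (1 + s) ≤
        ∑ b, √((∑ x, if h x = b then p x else 0) / 2 ^ k) := by
  classical
  let K := GaloisField 2 N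
  have : Fintype K := Fintype.ofFinite K
  let e : (Fin N → ZMod 2) ≃ₗ[ZMod 2] K := LinearEquiv.ofFinrankEq _ _ (by
    rw [GaloisField.finrank 2 hN, Module.finrank_fin_fun])
  let π : K →ₗ[ZMod 2] (Fin k → ZMod 2) :=
    LinearMap.funLeft (ZMod 2) (ZMod 2) (Fin.castLE hk) ∘ₗ e.symm.toLinearMap
  have hπ : Function.Surjective π :=
    (LinearMap.funLeft_surjective_of_injective (ZMod 2) (ZMod 2) _ (Fin.castLE_injective hk)).comp
      e.symm.surjective
  let h : K → (Fin N → ZMod 2) →ₗ[ZMod 2] (Fin k → ZMod 2) := fun t =>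
    π ∘ₗ LinearMap.mulLeft (ZMod 2) t ∘ₗ e.toLinearMap
  have happ : ∀ t x, h t x = π (t * e x) := fun t x => rfl
  have hcardK : Fintype.card K = 2 ^ N := by
    rw [← Nat.card_eq_fintype_card, GaloisField.card 2 N hN]
  have hker : (Finset.univ.filter fun u : K => π u = 0).card * 2 ^ k = 2 ^ N := by
    have h1 := Submodule.card_eq_card_quotient_mul_card (LinearMap.ker π)
    rw [Nat.card_congr (π.quotKerEquivOfSurjective hπ).toEquiv, Nat.card_eq_fintype_card,
      Nat.card_eq_fintype_card, Nat.card_eq_fintype_card, hcardK] at h1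
    have h2 : Fintype.card (LinearMap.ker π) =
        (Finset.univ.filter fun u : K => π u = 0).card := by
      rw [Fintype.card_subtype]
      simp only [LinearMap.mem_ker]
    rw [h1, h2]
    simp
  have hne : (Finset.univ.filter fun t : K => t ≠ 0).Nonempty := ⟨1, by simp⟩
  have huniv : ∀ x y, x ≠ y → (2 : ℝ) ^ k * ((Finset.univ.filter fun t : K => t ≠ 0).filter
      fun t => h t x = h t y).card ≤ (Finset.univ.filter fun t : K => t ≠ 0).card := by
    intro x y hxy
    have hv : e (x - y) ≠ 0 := by
      rw [Ne, e.map_eq_zero_iff, sub_eq_zero]; exact hxy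
    -- As `t` runs over the nonzero elements, so does `t * e (x - y)`. Hence collisions correspond
    -- to nonzero kernel elements: `2^(N-k) - 1` of the `2^N - 1` values of `t`, a fraction of at
    -- most `2^(-k)`.
    have h1 : ((Finset.univ.filter fun t : K => t ≠ 0).filter fun t => h t x = h t y).card + 1 =
        (Finset.univ.filter fun u : K => π u = 0).card := by
      have h2 : ((Finset.univ.filter fun t : K => t ≠ 0).filter fun t => h t x = h t y).card =
          ((Finset.univ.filter fun u : K => π u = 0).erase 0).card := by
        refine Finset.card_bij (fun t _ => t * e (x - y)) (fun t ht => ?_) (fun a _ b _ hab => ?_)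
          fun u hu => ?_
        · simp only [Finset.mem_filter, Finset.mem_univ, true_and] at ht
          simp only [Finset.mem_erase, Finset.mem_filter, Finset.mem_univ, true_and]
          exact ⟨mul_ne_zero ht.1 hv, by rw [← happ, map_sub, ht.2, sub_self]⟩
        · exact mul_right_cancel₀ hv hab
        · simp only [Finset.mem_erase, Finset.mem_filter, Finset.mem_univ, true_and] at hu
          refine ⟨u / e (x - y), ?_, div_mul_cancel₀ u hv⟩
          simp only [Finset.mem_filter, Finset.mem_univ, true_and]
          exact ⟨div_ne_zero hu.1 hv, by
            rw [← sub_eq_zero, ← map_sub, happ, div_mul_cancel₀ u hv, hu.2]⟩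
      rw [h2, Finset.card_erase_add_one]
      simp
    have h3 : (Finset.univ.filter fun t : K => t ≠ 0).card + 1 = 2 ^ N := by
      rw [Finset.filter_ne', Finset.card_erase_add_one (Finset.mem_univ _), Finset.card_univ,
        hcardK]
    have h4 : 2 ^ k * ((Finset.univ.filter fun t : K => t ≠ 0).filter
        fun t => h t x = h t y).card ≤ (Finset.univ.filter fun t : K => t ≠ 0).card := by
      rw [← h1] at hker
      have : 1 ≤ 2 ^ k := Nat.one_le_two_pow
      nlinarith
    exact_mod_cast h4
  obtain ⟨t, ht, hF⟩ := exists_hash_fidelity_ge (Finset.univ.filter fun t : K => t ≠ 0) hne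
    (fun t x => h t x) (2 ^ k) (by positivity) huniv p hp hp1 s hs0 hs1
  have ht0 : t ≠ 0 := (Finset.mem_filter.1 ht).2
  refine ⟨h t, fun b => ?_, hF⟩
  obtain ⟨u, hu⟩ := hπ b
  exact ⟨e.symm (t⁻¹ * u), by rw [happ, e.apply_symm_apply, mul_inv_cancel_left₀ ht0, hu]⟩

/-! ### Characters of `(ZMod 2)ⁿ` and the Fourier-basis measurement -/

/-- The nontrivial sign character of `ZMod 2`. -/
def sgn (a : ZMod 2) : ℝ := if a = 0 then 1 else -1

theorem zmod_two_cases (a : ZMod 2) : a = 0 ∨ a = 1 := by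
  revert a; decide

theorem sgn_zero : sgn 0 = 1 := rfl

theorem sgn_one : sgn 1 = -1 := rfl

theorem sgn_add (a b : ZMod 2) : sgn (a + b) = sgn a * sgn b := by
  rcases zmod_two_cases a with rfl | rfl <;> rcases zmod_two_cases b with rfl | rfl <;>
    simp [sgn, show (1 : ZMod 2) + 1 = 0 from rfl]

theorem sgn_mul_self (a : ZMod 2) : sgn a * sgn a = 1 := by
  rcases zmod_two_cases a with rfl | rfl <;> simp [sgn]

theorem sgn_sum {ι : Type*} (t : Finset ι) (f : ι → ZMod 2) :
    sgn (∑ i ∈ t, f i) = ∏ i ∈ t, sgn (f i) := by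
  classical
  induction t using Finset.induction_on with
  | empty => simp [sgn_zero]
  | insert i t hi ih => rw [Finset.sum_insert hi, Finset.prod_insert hi, sgn_add, ih]

theorem sgn_natCast (n : ℕ) : sgn (n : ZMod 2) = (-1) ^ n := by
  induction n with
  | zero => simp [sgn_zero]
  | succ n ih => rw [Nat.cast_succ, sgn_add, ih, sgn_one, pow_succ]

theorem sum_sgn_dotProduct {k : ℕ} (x : Fin k → ZMod 2) :
    ∑ b : Fin k → ZMod 2, sgn (x ⬝ᵥ b) = if x = 0 then 2 ^ k else 0 := by
  split_ifs with hx
  · simp [hx, sgn_zero]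
  · obtain ⟨i, hi⟩ := Function.ne_iff.1 hx
    have hi1 : x i = 1 := (zmod_two_cases _).resolve_left hi
    -- Flipping bit `i` of `b` reverses the sign, so the sum equals its own negative.
    have h := Equiv.sum_comp (Equiv.addRight (Pi.single i 1 : Fin k → ZMod 2))
      fun b => sgn (x ⬝ᵥ b)
    simp only [Equiv.coe_addRight, dotProduct_add, dotProduct_single_one, sgn_add, hi1, sgn_one,
      mul_neg_one, Finset.sum_neg_distrib] at h
    linarith

theorem sum_sgn_mul_sgn {k : ℕ} (x y : Fin k → ZMod 2) :
    ∑ b : Fin k → ZMod 2, sgn (x ⬝ᵥ b) * sgn (y ⬝ᵥ b) = if x = y then 2 ^ k else 0 := by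
  have h2 : x + y = 0 ↔ x = y := by
    have : y + y = 0 := by ext i; exact CharTwo.add_self_eq_zero _
    constructor
    · intro h
      calc x = x + (y + y) := by rw [this, add_zero]
        _ = y := by rw [← add_assoc, h, zero_add]
    · rintro rfl; exact this
  simp_rw [← sgn_add, ← add_dotProduct, sum_sgn_dotProduct, h2]

/-- Measuring in the Fourier basis of an orthonormal family indexed by `(ZMod 2)ᵏ`. -/
theorem exists_fourier_measurement {H : Type*} [NormedAddCommGroup H] [InnerProductSpace ℂ H]
    [CompleteSpace H] {k : ℕ} (f : (Fin k → ZMod 2) → H) (hf : Orthonormal ℂ f)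
    (ε : Fin (2 ^ k) ≃ (Fin k → ZMod 2)) :
    ∃ P : ProjectiveMeasurement H (2 ^ k), ∀ β : (Fin k → ZMod 2) → ℝ, ∀ y,
      P.prob (∑ b, ((β b : ℝ) : ℂ) • f b) y =
        (∑ b, (√(2 ^ k))⁻¹ * (sgn (ε y ⬝ᵥ b) * β b)) ^ 2 := by
  set e : Fin (2 ^ k) → H := fun x =>
    ∑ b, (((√(2 ^ k))⁻¹ * sgn (ε x ⬝ᵥ b) : ℝ) : ℂ) • f b with he
  have hM : (√(2 ^ k : ℝ))⁻¹ * (√(2 ^ k : ℝ))⁻¹ * 2 ^ k = 1 := by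
    rw [← mul_inv, Real.mul_self_sqrt (by positivity), inv_mul_cancel₀ (by positivity)]
  have hin : ∀ x (β : (Fin k → ZMod 2) → ℝ), inner ℂ (e x) (∑ b, ((β b : ℝ) : ℂ) • f b) =
      ((∑ b, (√(2 ^ k))⁻¹ * (sgn (ε x ⬝ᵥ b) * β b) : ℝ) : ℂ) := fun x β => by
    rw [he, hf.inner_sum]
    push_cast
    refine Finset.sum_congr rfl fun b _ => ?_
    simp only [map_mul, map_inv₀, Complex.conj_ofReal]
    ring
  have heo : Orthonormal ℂ e := orthonormal_iff_ite.2 fun x y => by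
    rw [show e y = ∑ b, (((√(2 ^ k))⁻¹ * sgn (ε y ⬝ᵥ b) : ℝ) : ℂ) • f b from rfl, hin]
    have : ∑ b, (√(2 ^ k : ℝ))⁻¹ * (sgn (ε x ⬝ᵥ b) * ((√(2 ^ k : ℝ))⁻¹ * sgn (ε y ⬝ᵥ b))) =
        (√(2 ^ k : ℝ))⁻¹ * (√(2 ^ k : ℝ))⁻¹ *
          ∑ b, sgn (ε x ⬝ᵥ b) * sgn (ε y ⬝ᵥ b) := by
      rw [Finset.mul_sum]
      exact Finset.sum_congr rfl fun b _ => by ring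
    rw [this, sum_sgn_mul_sgn]
    by_cases hxy : x = y
    · simp only [hxy, if_true, hM, Complex.ofReal_one]
    · simp [hxy]
  obtain ⟨P, hP⟩ := exists_measurement_of_orthonormal (by positivity) e heo
  refine ⟨P, fun β y => ?_⟩
  rw [hP, hin, Complex.norm_real, Real.norm_eq_abs, sq_abs]
  -- What remains is that the state lies in the span of the Fourier vectors, as the measurement
  -- lemma requires: Fourier inversion.
  simp_rw [hin]
  simp only [he, Finset.smul_sum, smul_smul]
  rw [Finset.sum_comm]
  refine Finset.sum_congr rfl fun b _ => ?_
  rw [← Finset.sum_smul]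
  congr 1
  simp only [← Complex.ofReal_mul, ← Complex.ofReal_sum]
  congr 1
  calc ∑ x, (∑ c, (√(2 ^ k : ℝ))⁻¹ * (sgn (ε x ⬝ᵥ c) * β c)) *
        ((√(2 ^ k : ℝ))⁻¹ * sgn (ε x ⬝ᵥ b))
      = (√(2 ^ k : ℝ))⁻¹ * (√(2 ^ k : ℝ))⁻¹ *
          ∑ c, β c * ∑ x : Fin (2 ^ k), sgn (c ⬝ᵥ ε x) * sgn (b ⬝ᵥ ε x) := by
        simp_rw [Finset.mul_sum, Finset.sum_mul]
        rw [Finset.sum_comm]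
        refine Finset.sum_congr rfl fun c _ => Finset.sum_congr rfl fun x _ => ?_
        rw [dotProduct_comm c, dotProduct_comm b]
        ring
    _ = (√(2 ^ k : ℝ))⁻¹ * (√(2 ^ k : ℝ))⁻¹ * ∑ c, β c * if c = b then 2 ^ k else 0 := by
        congr 1
        refine Finset.sum_congr rfl fun c _ => ?_
        rw [ε.sum_comp fun x => sgn (c ⬝ᵥ x) * sgn (b ⬝ᵥ x), sum_sgn_mul_sgn]
    _ = β b := by
        simp only [mul_ite, mul_zero, Finset.sum_ite_eq', Finset.mem_univ, if_true]
        linear_combination β b * hM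

/-! ### Photon-number amplitudes of BPSK codewords -/

/-- Number-state amplitude of the coherent state `|√E⟩`. -/
def amp (E : ℝ) (n : ℕ) : ℝ := Real.exp (-E / 2) * √E ^ n / √(n.factorial : ℝ)

/-- Probability of an even (`a = 0`) or odd (`a = 1`) photon number in `|±√E⟩`. -/
def lam (E : ℝ) (a : ZMod 2) : ℝ := (1 + sgn a * Real.exp (-(2 * E))) / 2

/-- The BPSK symbol that encodes a bit. -/
def symbol (a : ZMod 2) : Bool := decide (a = 0)

theorem amp_sq {E : ℝ} (hE : 0 ≤ E) (n : ℕ) :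
    amp E n ^ 2 = Real.exp (-E) * (E ^ n / n.factorial) := by
  rw [amp, div_pow, mul_pow, Real.sq_sqrt (Nat.cast_nonneg _), ← pow_mul, mul_comm n, pow_mul,
    Real.sq_sqrt hE, ← Real.exp_nat_mul]
  rw [show ((2 : ℕ) : ℝ) * (-E / 2) = -E by push_cast; ring]
  ring

theorem bpsk_apply {E : ℝ} (hE : 0 ≤ E) (a : ZMod 2) (n : ℕ) :
    bpsk E (symbol a) n = ((sgn (a * n) * amp E n : ℝ) : ℂ) := by
  have h0 : ∀ z : ℂ, ‖z‖ = √E →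
      coherentAmplitude z n = (Real.exp (-E / 2) : ℂ) * z ^ n / (√(n.factorial : ℝ) : ℂ) := by
    intro z hz
    rw [coherentAmplitude, hz, Real.sq_sqrt hE]
  have hn : ‖(√E : ℂ)‖ = √E := by
    rw [Complex.norm_real, Real.norm_eq_abs, abs_of_nonneg (Real.sqrt_nonneg E)]
  rcases zmod_two_cases a with rfl | rfl
  · change coherentAmplitude (√E : ℂ) n = _
    rw [h0 _ hn, zero_mul, sgn_zero, amp]
    push_cast
    ring
  · change coherentAmplitude (-(√E : ℂ)) n = _
    rw [h0 _ (by rw [norm_neg, hn]), one_mul, sgn_natCast, amp, neg_pow]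
    push_cast
    ring

theorem hasSum_amp_sq {E : ℝ} (hE : 0 ≤ E) : HasSum (fun n => amp E n ^ 2) 1 := by
  have h := (NormedSpace.expSeries_div_hasSum_exp E).mul_left (Real.exp (-E))
  rw [← Real.exp_eq_exp_ℝ, ← Real.exp_add, neg_add_cancel, Real.exp_zero] at h
  simpa only [amp_sq hE] using h

theorem hasSum_neg_one_pow_mul_amp_sq {E : ℝ} (hE : 0 ≤ E) :
    HasSum (fun n => (-1) ^ n * amp E n ^ 2) (Real.exp (-(2 * E))) := by
  have h := (NormedSpace.expSeries_div_hasSum_exp (-E)).mul_left (Real.exp (-E))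
  rw [← Real.exp_eq_exp_ℝ, ← Real.exp_add, ← two_mul, mul_neg] at h
  refine h.congr_fun fun n => ?_
  rw [amp_sq hE, neg_pow]
  ring

theorem hasSum_lam {E : ℝ} (hE : 0 ≤ E) (a : ZMod 2) :
    HasSum (fun n : ℕ => if (n : ZMod 2) = a then amp E n ^ 2 else 0) (lam E a) := by
  have h := ((hasSum_amp_sq hE).add ((hasSum_neg_one_pow_mul_amp_sq hE).mul_left (sgn a))).mul_left
    (1 / 2)
  rw [show 1 / 2 * (1 + sgn a * Real.exp (-(2 * E))) = lam E a by rw [lam]; ring] at h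
  refine h.congr_fun fun n => ?_
  have h1 : sgn a * (-1) ^ n = if (n : ZMod 2) = a then 1 else -1 := by
    rw [← sgn_natCast]
    generalize (n : ZMod 2) = b
    rcases zmod_two_cases a with rfl | rfl <;> rcases zmod_two_cases b with rfl | rfl <;>
      simp [sgn]
  rw [← mul_assoc (sgn a), h1]
  split_ifs <;> ring

theorem hasSum_prod_pi {N : ℕ} (f : Fin N → ℕ → ℝ) (a : Fin N → ℝ) (h0 : ∀ i m, 0 ≤ f i m)
    (h : ∀ i, HasSum (f i) (a i)) :
    HasSum (fun n : Fin N → ℕ => ∏ i, f i (n i)) (∏ i, a i) := by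
  induction N with
  | zero =>
    rw [Fin.prod_univ_zero]
    simpa only [Fin.prod_univ_zero] using hasSum_unique fun _ : Fin 0 → ℕ => (1 : ℝ)
  | succ N ih =>
    obtain ⟨g, hg⟩ : ∃ g : (Fin N → ℕ) → ℝ, g = fun n => ∏ i, f i.succ (n i) := ⟨_, rfl⟩
    have hg0 : 0 ≤ g := fun n => by
      rw [hg]
      exact Finset.prod_nonneg fun i _ => h0 _ _
    have ih' : HasSum g (∏ i : Fin N, a i.succ) := by
      rw [hg]
      exact ih (fun i => f i.succ) (fun i => a i.succ) (fun i => h0 i.succ) fun i => h i.succ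
    have h2 := (h 0).mul ih' ((h 0).summable.mul_of_nonneg ih'.summable (h0 0) hg0)
    rw [Fin.prod_univ_succ, ← (Fin.consEquiv fun _ : Fin (N + 1) => ℕ).hasSum_iff]
    refine h2.congr_fun fun x => ?_
    simp only [hg, Function.comp_apply, Fin.consEquiv, Equiv.coe_fn_mk, Fin.prod_univ_succ,
      Fin.cons_zero, Fin.cons_succ]

/-! ### Linear codes and the achievable block capacity -/

/-- Photon-number parities of the modes. -/
def parity {N : ℕ} (n : Fin N → ℕ) : Fin N → ZMod 2 := fun i => n i

/-- Number-state amplitude of `|√E⟩ ⊗ ⋯ ⊗ |√E⟩`. -/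
def amps (E : ℝ) {N : ℕ} (n : Fin N → ℕ) : ℝ := ∏ i, amp E (n i)

/-- The distribution of the photon-number parities. -/
def parityDist (E : ℝ) {N : ℕ} (S : Fin N → ZMod 2) : ℝ := ∏ i, lam E (S i)

/-- The product state that encodes a word. -/
def codeState (E : ℝ) {N : ℕ} (x : Fin N → ZMod 2) : Modes N :=
  tensorState fun i => bpsk E (symbol (x i))

/-- The message enters only through a character of the parity vector, which turns the quantum
problem into one about the parity distribution. -/
theorem codeState_apply {E : ℝ} (hE : 0 ≤ E) {N : ℕ} (x : Fin N → ZMod 2) (n : Fin N → ℕ) :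
    codeState E x n = ((sgn (x ⬝ᵥ parity n) * amps E n : ℝ) : ℂ) := by
  change ∏ i, bpsk E (symbol (x i)) (n i) = _
  simp_rw [bpsk_apply hE]
  rw [← Complex.ofReal_prod, Finset.prod_mul_distrib, dotProduct, sgn_sum]
  rfl

theorem hasSum_amps_sq {E : ℝ} (hE : 0 ≤ E) (N : ℕ) :
    HasSum (fun n : Fin N → ℕ => amps E n ^ 2) 1 := by
  have h := hasSum_prod_pi (fun (_ : Fin N) m => amp E m ^ 2) (fun _ => 1)
    (fun _ _ => sq_nonneg _) fun _ => hasSum_amp_sq hE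
  simpa only [amps, Finset.prod_pow, Finset.prod_const_one] using h

theorem hasSum_parityDist {E : ℝ} (hE : 0 ≤ E) {N : ℕ} (S : Fin N → ZMod 2) :
    HasSum (fun n : Fin N → ℕ => if parity n = S then amps E n ^ 2 else 0) (parityDist E S) := by
  have h := hasSum_prod_pi (fun (i : Fin N) (m : ℕ) => if (m : ZMod 2) = S i then amp E m ^ 2 else 0)
    (fun i => lam E (S i)) (fun i m => by positivity) fun i => hasSum_lam hE (S i)
  refine h.congr_fun fun n => ?_
  by_cases hn : parity n = S
  · have : ∀ i, (n i : ZMod 2) = S i := fun i => congrFun hn i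
    simp only [hn, this, if_true, amps, Finset.prod_pow]
  · obtain ⟨i, hi⟩ := Function.ne_iff.1 hn
    rw [if_neg hn, eq_comm]
    exact Finset.prod_eq_zero (Finset.mem_univ i) (if_neg hi)

theorem hasSum_hash {E : ℝ} (hE : 0 ≤ E) {N : ℕ} {β : Type*} [DecidableEq β]
    (h : (Fin N → ZMod 2) → β) (b : β) :
    HasSum (fun n : Fin N → ℕ => if h (parity n) = b then amps E n ^ 2 else 0)
      (∑ S, if h S = b then parityDist E S else 0) := by
  have h1 := hasSum_sum (s := Finset.univ.filter fun S => h S = b)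
    fun S _ => hasSum_parityDist (E := E) hE (N := N) S
  rw [Finset.sum_filter] at h1
  refine h1.congr_fun fun n => ?_
  rw [Finset.sum_ite_eq]
  simp

theorem lam_pos {E : ℝ} (hE : 0 < E) (a : ZMod 2) : 0 < lam E a := by
  have h : Real.exp (-(2 * E)) < 1 := Real.exp_lt_one_iff.2 (by linarith)
  have h0 := Real.exp_pos (-(2 * E))
  rcases zmod_two_cases a with rfl | rfl
  · rw [lam, sgn_zero]; linarith
  · rw [lam, sgn_one]; linarith

theorem lam_zero_add_lam_one (E : ℝ) : lam E 0 + lam E 1 = 1 := by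
  rw [lam, lam, sgn_zero, sgn_one]; ring

theorem sum_prod_zmod_two (N : ℕ) (g : ZMod 2 → ℝ) :
    ∑ S : Fin N → ZMod 2, ∏ i, g (S i) = (g 0 + g 1) ^ N := by
  have h : g 0 + g 1 = ∑ a : ZMod 2, g a := (Fin.sum_univ_two g).symm
  rw [h, Fintype.sum_pow]

theorem norm_codeState {E : ℝ} (hE : 0 ≤ E) {N : ℕ} (x : Fin N → ZMod 2) :
    ‖codeState E x‖ = 1 := by
  have h := lp.hasSum_inner (𝕜 := ℂ) (codeState E x) (codeState E x)
  have h1 : HasSum (fun n : Fin N → ℕ => ((amps E n ^ 2 : ℝ) : ℂ)) ((1 : ℝ) : ℂ) :=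
    Complex.hasSum_ofReal.2 (hasSum_amps_sq hE N)
  have h2 : (fun n => inner ℂ (codeState E x n) (codeState E x n)) =
      fun n : Fin N → ℕ => ((amps E n ^ 2 : ℝ) : ℂ) := by
    ext n
    rw [codeState_apply hE, RCLike.inner_apply, Complex.conj_ofReal, ← Complex.ofReal_mul]
    congr 1
    linear_combination (amps E n ^ 2) * sgn_mul_self (x ⬝ᵥ parity n)
  rw [h2] at h
  have h3 := h.unique h1
  rw [inner_self_eq_norm_sq_to_K] at h3
  have h4 : ‖codeState E x‖ ^ 2 = 1 := by
    refine Complex.ofReal_injective (Eq.trans ?_ h3)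
    push_cast
    rfl
  nlinarith [norm_nonneg (codeState E x)]

/-- The part of `|√E⟩ ⊗ ⋯ ⊗ |√E⟩` with parities in the class `b` of the hash `h`, normalized. -/
theorem exists_hash_orthonormal {E : ℝ} (hE : 0 < E) {N k : ℕ}
    (h : (Fin N → ZMod 2) →ₗ[ZMod 2] (Fin k → ZMod 2)) (hs : Function.Surjective h) :
    ∃ f : (Fin k → ZMod 2) → Modes N, Orthonormal ℂ f ∧ ∀ y : Fin k → ZMod 2,
      codeState E (fun i => y ⬝ᵥ h (Pi.single i 1)) =
        ∑ b, ((sgn (y ⬝ᵥ b) * √(∑ S, if h S = b then parityDist E S else 0) : ℝ) : ℂ) • f b := by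
  set w : (Fin k → ZMod 2) → ℝ := fun b => ∑ S, if h S = b then parityDist E S else 0 with hw
  have hpos : ∀ S : Fin N → ZMod 2, 0 < parityDist E S := fun S =>
    Finset.prod_pos fun i _ => lam_pos hE _
  have hw0 : ∀ b, 0 < w b := fun b => by
    obtain ⟨S, hS⟩ := hs b
    refine Finset.sum_pos' (fun S _ => ?_) ⟨S, Finset.mem_univ S, ?_⟩
    · split_ifs
      exacts [(hpos S).le, le_rfl]
    · rw [if_pos hS]; exact hpos S
  have hsum : ∀ b, HasSum (fun n : Fin N → ℕ => if h (parity n) = b then amps E n ^ 2 else 0)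
      (w b) := fun b => hasSum_hash hE.le h b
  have hmem : ∀ b, Memℓp (fun n : Fin N → ℕ =>
      (((if h (parity n) = b then (√(w b))⁻¹ * amps E n else 0 : ℝ)) : ℂ)) 2 := fun b => by
    refine (memℓp_gen_iff (by norm_num)).2 ?_
    refine ((hsum b).mul_left (w b)⁻¹).summable.congr fun n => ?_
    rw [Complex.norm_real, ENNReal.toReal_ofNat, Real.rpow_ofNat, Real.norm_eq_abs, sq_abs]
    split_ifs
    · rw [mul_pow, inv_pow, Real.sq_sqrt (hw0 b).le]
    · simp
  set f : (Fin k → ZMod 2) → Modes N := fun b => ⟨_, hmem b⟩ with hf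
  have hfap : ∀ b n, f b n = ((if h (parity n) = b then (√(w b))⁻¹ * amps E n else 0 : ℝ) : ℂ) :=
    fun b n => rfl
  refine ⟨f, orthonormal_iff_ite.2 fun b c => ?_, fun y => ?_⟩
  · refine (lp.hasSum_inner (𝕜 := ℂ) (f b) (f c)).unique ?_
    simp_rw [hfap, RCLike.inner_apply, Complex.conj_ofReal, ← Complex.ofReal_mul]
    split_ifs with hbc
    · subst hbc
      have h1 := (hsum b).mul_left (w b)⁻¹
      rw [inv_mul_cancel₀ (hw0 b).ne'] at h1
      have h2 := Complex.hasSum_ofReal.2 h1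
      rw [Complex.ofReal_one] at h2
      refine h2.congr_fun fun n => ?_
      congr 1
      split_ifs
      · have := Real.mul_self_sqrt (hw0 b).le
        have h3 : (√(w b))⁻¹ * (√(w b))⁻¹ = (w b)⁻¹ := by rw [← mul_inv, this]
        linear_combination (amps E n) ^ 2 * h3
      · simp
    · refine hasSum_zero.congr_fun fun n => ?_
      by_cases h1 : h (parity n) = b
      · have h2 : ¬ h (parity n) = c := fun h2 => hbc (h1.symm.trans h2)
        simp [h2]
      · simp [h1]
  · ext n
    -- The codeword is the transpose of `h` applied to `y`.
    have hdot : (fun i => y ⬝ᵥ h (Pi.single i 1)) ⬝ᵥ parity n = y ⬝ᵥ h (parity n) := by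
      rw [LinearMap.pi_apply_eq_sum_univ h (parity n), dotProduct_sum, dotProduct]
      refine Finset.sum_congr rfl fun i _ => ?_
      have hi : (fun j => if i = j then (1 : ZMod 2) else 0) = Pi.single i 1 := by
        ext j
        simp [Pi.single_apply, eq_comm]
      rw [dotProduct_smul, smul_eq_mul, mul_comm, hi]
    rw [codeState_apply hE.le, hdot, lp.coeFn_sum, Finset.sum_apply]
    simp only [lp.coeFn_smul, Pi.smul_apply, hfap, smul_eq_mul, ← Complex.ofReal_mul,
      ← Complex.ofReal_sum]
    congr 1
    rw [Finset.sum_eq_single (h (parity n))]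
    · rw [if_pos rfl]
      have := (Real.sqrt_pos.2 (hw0 (h (parity n)))).ne'
      change _ = sgn _ * √(w (h (parity n))) * _
      field_simp
    · intro b _ hb
      rw [if_neg fun h' => hb h'.symm, mul_zero]
    · exact fun h' => absurd (Finset.mem_univ _) h'

/-- Since `sSup` of an unbounded set of reals is 0, a code bounds `blockCapacity` from below only
once this is known. -/
theorem bddAbove_mutualInfo {E : ℝ} (hE : 0 ≤ E) (N : ℕ) :
    BddAbove {I : ℝ | ∃ (M : ℕ) (c : Fin M → Fin N → Bool)
      (P : ProjectiveMeasurement (Modes N) M),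
      ∃ p ∈ stdSimplex ℝ (Fin M), I = mutualInfo p (superchannel (bpsk E) c P)} := by
  refine ⟨Fintype.card (Fin N → Bool), ?_⟩
  rintro I ⟨M, c, P, p, hp, rfl⟩
  refine mutualInfo_le_card c (fun x k => P.prob (tensorState fun i => bpsk E (x i)) k)
    (fun x k => sq_nonneg _) (fun x => ?_) p hp
  have hx : (tensorState fun i => bpsk E (x i)) =
      codeState E fun i => if x i then (0 : ZMod 2) else 1 := by
    rw [codeState]
    congr 1
    ext1 i
    congr 1
    cases x i <;> simp [symbol]
  rw [P.sum_prob, hx, norm_codeState hE, one_pow]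

/-- Achievability with linear codes, with the error exponent of random coding. -/
theorem blockCapacity_ge {E : ℝ} (hE : 0 < E) {N k : ℕ} (hN : N ≠ 0) (hk : k ≤ N) {s : ℝ}
    (hs0 : 0 ≤ s) (hs1 : s ≤ 1) :
    (1 - 2 * (((2 : ℝ) ^ k) ^ s * (lam E 0 ^ (1 + s) + lam E 1 ^ (1 + s)) ^ N)) *
      Real.log (2 ^ k) - 2 ≤ blockCapacity (bpsk E) N := by
  have hpos : ∀ S : Fin N → ZMod 2, 0 < parityDist E S := fun S =>
    Finset.prod_pos fun i _ => lam_pos hE _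
  have hsum1 : ∑ S : Fin N → ZMod 2, parityDist E S = 1 := by
    rw [show (1 : ℝ) = (lam E 0 + lam E 1) ^ N by rw [lam_zero_add_lam_one, one_pow]]
    exact sum_prod_zmod_two N (lam E)
  obtain ⟨h, hsurj, hF⟩ := exists_linear_hash hN hk (parityDist E) (fun S => (hpos S).le) hsum1 s
    hs0 hs1
  have hpow : ∑ S : Fin N → ZMod 2, parityDist E S ^ (1 + s) =
      (lam E 0 ^ (1 + s) + lam E 1 ^ (1 + s)) ^ N := by
    rw [← sum_prod_zmod_two N fun a => lam E a ^ (1 + s)]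
    exact Finset.sum_congr rfl fun S _ =>
      (Real.finsetProd_rpow _ _ (fun i _ => (lam_pos hE _).le) _).symm
  rw [hpow] at hF
  obtain ⟨f, hf, hψ⟩ := exists_hash_orthonormal hE h hsurj
  have ε : Fin (2 ^ k) ≃ (Fin k → ZMod 2) := (Fintype.equivFinOfCardEq (by simp)).symm
  obtain ⟨P, hP⟩ := exists_fourier_measurement f hf ε
  set c : Fin (2 ^ k) → Fin N → Bool := fun j i => symbol (ε j ⬝ᵥ h (Pi.single i 1)) with hc
  set w : (Fin k → ZMod 2) → ℝ := fun b => ∑ S, if h S = b then parityDist E S else 0 with hw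
  have hW : ∀ j y, superchannel (bpsk E) c P j y =
      (∑ b, (√(2 ^ k))⁻¹ * (sgn (ε y ⬝ᵥ b) * (sgn (ε j ⬝ᵥ b) * √(w b)))) ^ 2 := fun j y => by
    rw [← hP, ← hψ]
    rfl
  -- Symmetry turns the row sums 1 into the column sums 1 needed by `mutualInfo_uniform_ge`.
  have hsymm : ∀ j y, superchannel (bpsk E) c P j y = superchannel (bpsk E) c P y j := fun j y => by
    rw [hW, hW]
    congr 1
    exact Finset.sum_congr rfl fun b _ => by ring
  set ε₀ := ((2 : ℝ) ^ k) ^ s * (lam E 0 ^ (1 + s) + lam E 1 ^ (1 + s)) ^ N with hε₀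
  have hdiag : ∀ j, 1 - 2 * ε₀ ≤ superchannel (bpsk E) c P j j := fun j => by
    have h1 : ∑ b, (√(2 ^ k : ℝ))⁻¹ * (sgn (ε j ⬝ᵥ b) * (sgn (ε j ⬝ᵥ b) * √(w b))) =
        ∑ b, √(w b / 2 ^ k) := by
      refine Finset.sum_congr rfl fun b _ => ?_
      rw [← mul_assoc (sgn _), sgn_mul_self, one_mul, Real.sqrt_div' _ (by positivity),
        inv_mul_eq_div]
    rw [hW, h1]
    -- If the fidelity is `F ≥ 1 - ε₀`, then `F² ≥ 2F - 1 ≥ 1 - 2ε₀`.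
    nlinarith [sq_nonneg (∑ b, √(w b / 2 ^ k) - 1)]
  have hmain := mutualInfo_uniform_ge (M := 2 ^ k) (by positivity) (superchannel (bpsk E) c P)
    (fun j y => sq_nonneg _) (fun y => ?_) (2 * ε₀) hdiag
  · refine le_trans ?_ (hmain.trans (le_csSup (bddAbove_mutualInfo hE.le N)
      ⟨2 ^ k, c, P, _, ⟨fun _ => by positivity, ?_⟩, rfl⟩))
    · push_cast
      exact le_rfl
    · simp
  · simp_rw [hsymm _ y]
    exact (P.sum_prob _).trans (by
      rw [show (tensorState fun i => bpsk E (c y i)) =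
        codeState E fun i => ε y ⬝ᵥ h (Pi.single i 1) from rfl, norm_codeState hE.le, one_pow])

/-! ### Asymptotics of the achievable rate -/

theorem exp_neg_le_quadratic {y : ℝ} (hy : 0 ≤ y) : Real.exp (-y) ≤ 1 - y + y ^ 2 / 2 := by
  have h := Real.quadratic_le_exp_of_nonneg hy
  rw [Real.exp_neg, inv_le_iff_one_le_mul₀ (Real.exp_pos y)]
  have h1 : 0 ≤ 1 - y + y ^ 2 / 2 := by nlinarith [sq_nonneg (y - 1)]
  nlinarith [mul_le_mul_of_nonneg_left h h1, sq_nonneg (y ^ 2)]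

theorem lam_one_le (E : ℝ) : lam E 1 ≤ E := by
  have h := Real.add_one_le_exp (-(2 * E))
  rw [lam, sgn_one]
  linarith

theorem le_lam_one {E : ℝ} (hE : 0 ≤ E) : E - E ^ 2 ≤ lam E 1 := by
  have h := exp_neg_le_quadratic (y := 2 * E) (by linarith)
  rw [lam, sgn_one]
  linarith

/-- The exponent `δ / L` is chosen so that `E ^ (δ / L) = exp (-δ)`. The odd term is then at most `E
exp (-δ)`, and the even one at most `exp (-(1 + δ/L) * lam E 1)`; both are expanded to second order.
-/
theorem sum_lam_rpow_le {E L δ : ℝ} (hE : 0 < E) (hE1 : E ≤ 1) (hL : L = Real.log (1 / E))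
    (hL1 : 1 ≤ L) (hδ0 : 0 ≤ δ) (hδ1 : δ ≤ 1) :
    lam E 0 ^ (1 + δ / L) + lam E 1 ^ (1 + δ / L) ≤
      1 - δ / L * E + 4 * E ^ 2 - E * δ + E * δ ^ 2 / 2 := by
  have hL0 : 0 < L := by linarith
  set s := δ / L with hs
  have hs0 : 0 ≤ s := div_nonneg hδ0 hL0.le
  have hs1 : s ≤ 1 := (div_le_one hL0).2 (hδ1.trans hL1)
  have hsL : s * L = δ := div_mul_cancel₀ δ hL0.ne'
  have hl0 := lam_pos hE 1
  have hl1 := lam_one_le E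
  have hl2 := le_lam_one hE.le
  have hE2 : E ^ 2 ≤ E := by nlinarith
  have h1 : lam E 1 ^ (1 + s) ≤ E * (1 - δ + δ ^ 2 / 2) := by
    refine (Real.rpow_le_rpow hl0.le hl1 (by linarith)).trans ?_
    rw [Real.rpow_add hE, Real.rpow_one]
    refine mul_le_mul_of_nonneg_left ?_ hE.le
    have h3 : E ^ s = Real.exp (-δ) := by
      rw [Real.rpow_def_of_pos hE, ← hsL, hL, one_div, Real.log_inv]
      ring_nf
    rw [h3]
    exact exp_neg_le_quadratic hδ0
  have h0 : lam E 0 ^ (1 + s) ≤ 1 - (1 + s) * E + 4 * E ^ 2 := by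
    have h2 : lam E 0 ≤ Real.exp (-lam E 1) := by
      have := Real.add_one_le_exp (-lam E 1)
      linarith [lam_zero_add_lam_one E]
    have h3 : lam E 0 ^ (1 + s) ≤ Real.exp (-((1 + s) * lam E 1)) := by
      refine (Real.rpow_le_rpow (lam_pos hE 0).le h2 (by linarith)).trans ?_
      rw [← Real.exp_mul]
      exact Real.exp_le_exp.2 (by linarith)
    refine h3.trans ((exp_neg_le_quadratic (by positivity)).trans ?_)
    have h4 : (1 + s) * lam E 1 ≤ 2 * E := mul_le_mul (by linarith) hl1 hl0.le (by norm_num)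
    have h5 : ((1 + s) * lam E 1) ^ 2 ≤ (2 * E) ^ 2 := pow_le_pow_left₀ (by positivity) h4 2
    have h6 : (1 + s) * (E - E ^ 2) ≤ (1 + s) * lam E 1 :=
      mul_le_mul_of_nonneg_left hl2 (by linarith)
    nlinarith [mul_le_mul_of_nonneg_right hs1 (sq_nonneg E)]
  linarith

/-- Finite-length bound at rate `R = E L (1 - δ) + E`, where `L = log (1 / E)`. -/
theorem blockCapacity_ge_rate {E L δ R : ℝ} (hE : 0 < E) (hE1 : E ≤ 1)
    (hL : L = Real.log (1 / E)) (hL1 : 1 ≤ L) (hδ0 : 0 ≤ δ) (hδ1 : δ ≤ 1)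
    (hR : R = E * L * (1 - δ) + E) (hR2 : R ≤ Real.log 2) {N : ℕ} (hN : N ≠ 0)
    (hNE : N * E ^ 2 ≤ 1) :
    N * (R - 2 * Real.exp (4 - N * E * δ ^ 2 / 2) * R) - 3 ≤ blockCapacity (bpsk E) N := by
  have hL0 : 0 < L := by linarith
  set s := δ / L with hs
  have hs0 : 0 ≤ s := div_nonneg hδ0 hL0.le
  have hs1 : s ≤ 1 := (div_le_one hL0).2 (hδ1.trans hL1)
  have hsL : s * L = δ := div_mul_cancel₀ δ hL0.ne'
  have hlog2 : 0 < Real.log 2 := Real.log_pos (by norm_num)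
  have hN0 : (0 : ℝ) ≤ N := Nat.cast_nonneg N
  have hR0 : 0 ≤ R := by
    rw [hR]
    have := mul_nonneg (mul_nonneg hE.le hL0.le) (sub_nonneg.2 hδ1)
    linarith
  -- Rounding to whole bits costs at most `log 2 ≤ 1` nat, which raises the constant 2 of
  -- `blockCapacity_ge` to 3.
  set k := ⌊N * R / Real.log 2⌋₊ with hk
  have hk1 : k * Real.log 2 ≤ N * R := by
    rw [← le_div_iff₀ hlog2]
    exact Nat.floor_le (by positivity)
  have hk2 : N * R - Real.log 2 ≤ k * Real.log 2 := by
    have h := (Nat.lt_floor_add_one (N * R / Real.log 2)).le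
    rw [div_le_iff₀ hlog2] at h
    rw [hk]
    linarith
  have hkN : k ≤ N := by
    refine Nat.floor_le_of_le ?_
    rw [div_le_iff₀ hlog2]
    exact mul_le_mul_of_nonneg_left hR2 hN0
  have hmain := blockCapacity_ge hE hN hkN hs0 hs1
  have hQ := sum_lam_rpow_le hE hE1 hL hL1 hδ0 hδ1
  rw [← hs] at hQ
  set Q := lam E 0 ^ (1 + s) + lam E 1 ^ (1 + s) with hQd
  have hQ0 : 0 ≤ Q := add_nonneg (Real.rpow_nonneg (lam_pos hE 0).le _)
    (Real.rpow_nonneg (lam_pos hE 1).le _)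
  have h1 : ((2 : ℝ) ^ k) ^ s ≤ Real.exp (s * (N * R)) := by
    rw [Real.rpow_def_of_pos (by positivity), Real.log_pow]
    refine Real.exp_le_exp.2 ?_
    rw [mul_comm]
    exact mul_le_mul_of_nonneg_left hk1 hs0
  have h2 : Q ^ N ≤ Real.exp (N * (Q - 1)) := by
    rw [Real.exp_nat_mul]
    refine pow_le_pow_left₀ hQ0 ?_ N
    have := Real.add_one_le_exp (Q - 1)
    linarith
  -- In the exponent `s N R + N (Q - 1)`, the part `s E` due to the summand `E` of `R` cancels the
  -- `-s E` in `Q`: this is why the second-order term is attainable. There remain `-N E δ² / 2` and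
  -- `4 N E² ≤ 4`.
  have h3 : ((2 : ℝ) ^ k) ^ s * Q ^ N ≤ Real.exp (4 - N * E * δ ^ 2 / 2) := by
    refine (mul_le_mul h1 h2 (by positivity) (Real.exp_nonneg _)).trans ?_
    rw [← Real.exp_add]
    refine Real.exp_le_exp.2 ?_
    have h4 := mul_le_mul_of_nonneg_left hQ hN0
    have h5 : s * R = δ * E * (1 - δ) + s * E := by
      rw [hR]
      linear_combination E * (1 - δ) * hsL
    have h6 : s * (N * R) = N * (δ * E * (1 - δ) + s * E) := by rw [← h5]; ring
    rw [h6]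
    nlinarith
  rw [Real.log_pow] at hmain
  set ε := ((2 : ℝ) ^ k) ^ s * Q ^ N with hε
  have hε0 : 0 ≤ ε := by positivity
  have h7 : ε * (k * Real.log 2) ≤ Real.exp (4 - N * E * δ ^ 2 / 2) * (N * R) :=
    mul_le_mul h3 hk1 (by positivity) (Real.exp_nonneg _)
  have h8 : Real.log 2 ≤ 1 := Real.log_two_lt_d9.le.trans (by norm_num)
  linarith

theorem tendsto_log_one_div : Tendsto (fun E : ℝ => Real.log (1 / E)) (𝓝[>] 0) atTop := by
  simp only [one_div]
  exact Real.tendsto_log_atTop.comp tendsto_inv_nhdsGT_zero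

theorem isLittleO_mul_of_tendsto {g : ℝ → ℝ} (hg : Tendsto g (𝓝[>] 0) (𝓝 0)) :
    (fun E : ℝ => g E * E) =o[𝓝[>] 0] fun E : ℝ => E := by
  have h := ((isLittleO_one_iff ℝ).2 hg).mul_isBigO (isBigO_refl (fun E : ℝ => E) (𝓝[>] 0))
  simpa using h

theorem tendsto_const_div_sqrt_log_log (C : ℝ) :
    Tendsto (fun E : ℝ => C / √(Real.log (Real.log (1 / E)))) (𝓝[>] 0) (𝓝 0) :=
  tendsto_const_nhds.div_atTop (Real.tendsto_sqrt_atTop.comp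
    (Real.tendsto_log_atTop.comp tendsto_log_one_div))

/-- Powers of `log (1 / E)` are negligible against `1 / E`. -/
theorem tendsto_mul_log_pow (m : ℕ) :
    Tendsto (fun E : ℝ => E * Real.log (1 / E) ^ m) (𝓝[>] 0) (𝓝 0) := by
  have h := (Real.tendsto_pow_mul_exp_neg_atTop_nhds_zero m).comp tendsto_log_one_div
  refine h.congr' ?_
  filter_upwards [self_mem_nhdsWithin] with E hE
  have hE' : (0 : ℝ) < E := hE
  simp only [Function.comp_apply]
  rw [one_div, Real.log_inv, neg_neg, Real.exp_log hE', mul_comm]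

theorem log_mul_log_le {x : ℝ} (hx : 1 < x) : Real.log (x * Real.log x) ≤ 2 * Real.log x := by
  have h0 : 0 < Real.log x := Real.log_pos hx
  have hx0 : 0 < x := by linarith
  have h1 : Real.log x ≤ x := Real.log_le_self hx0.le
  rw [Real.log_mul hx0.ne' h0.ne']
  linarith [Real.log_le_log h0 h1]

theorem two_mul_log_le {x : ℝ} (hx : 0 < x) : 2 * Real.log x ≤ x := by
  have h := Real.log_le_sub_one_of_pos (Real.sqrt_pos.2 hx)
  rw [Real.log_sqrt hx.le] at h
  nlinarith [Real.sq_sqrt hx.le, sq_nonneg (√x - 2)]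

/-- With `x = N E`, the value of `δ` gives `exp (-x δ² / 2) = 1 / √(x log x)`. As `x ≥ L²`, this is
at most `1 / (L √(log L))`, so multiplying by a rate `R ≤ 2 E L` leaves a multiple of `E / √(log
L)`. The additive 3 costs `3 / N ≤ 3 E / L²`. Both bounds are free of `N`, whence the uniformity. -/
theorem blockCapacity_lower_bound :
    ∃ r : ℝ → ℝ, r =o[𝓝[>] 0] (fun E : ℝ => E) ∧
      ∀ᶠ E : ℝ in 𝓝[>] 0, ∀ N : ℕ,
        E⁻¹ * Real.log (1 / E) ^ 2 ≤ N → (N : ℝ) ≤ (E ^ 2)⁻¹ →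
        E * Real.log (1 / E) * (1 - Real.sqrt (Real.log (N * E * Real.log (N * E)) / (N * E)))
            + E + r E
          ≤ BPSK.blockCapacity (BPSK.bpsk E) N / N := by
  refine ⟨fun E => (-(4 * Real.exp 4 / √(Real.log (Real.log (1 / E))) +
    3 / Real.log (1 / E) ^ 2)) * E, isLittleO_mul_of_tendsto ?_, ?_⟩
  · have h1 : Tendsto (fun E : ℝ => 3 / Real.log (1 / E) ^ 2) (𝓝[>] 0) (𝓝 0) :=
      tendsto_const_nhds.div_atTop ((tendsto_pow_atTop two_ne_zero).comp tendsto_log_one_div)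
    simpa using ((tendsto_const_div_sqrt_log_log (4 * Real.exp 4)).add h1).neg
  have hlog2 : 0 < Real.log 2 / 2 := half_pos (Real.log_pos (by norm_num))
  filter_upwards [self_mem_nhdsWithin, tendsto_log_one_div.eventually_ge_atTop 3,
    (tendsto_mul_log_pow 1).eventually_le_const hlog2] with E hE hL3 hEL N hN1 hN2
  have hE0 : (0 : ℝ) < E := hE
  obtain ⟨L, hL⟩ : ∃ L, L = Real.log (1 / E) := ⟨_, rfl⟩
  rw [← hL] at hL3 hEL hN1 ⊢
  rw [pow_one] at hEL
  have hlogL : 1 < Real.log L := by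
    rw [Real.lt_log_iff_exp_lt (by linarith)]
    exact Real.exp_one_lt_d9.trans_le (by norm_num; linarith)
  have hE1 : E ≤ 1 := by
    by_contra! h
    have : Real.log (1 / E) ≤ 0 := by
      rw [one_div, Real.log_inv]
      linarith [Real.log_pos h]
    linarith
  obtain ⟨x, hx⟩ : ∃ x, x = N * E := ⟨_, rfl⟩
  have hxL : L ^ 2 ≤ x := by
    rw [hx]
    rwa [inv_mul_le_iff₀ hE0, mul_comm] at hN1
  have hx1 : 1 < x := by nlinarith
  have hx0 : 0 < x := by linarith
  have hN0 : (0 : ℝ) < N := by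
    have h : 0 < N * E := hx ▸ hx0
    exact pos_of_mul_pos_left h hE0.le
  have hlogx : Real.log L ≤ Real.log x := Real.log_le_log (by linarith) (by nlinarith)
  have hy : L ^ 2 * Real.log L ≤ x * Real.log x := mul_le_mul hxL hlogx (by linarith) hx0.le
  have hy0 : 0 < L ^ 2 * Real.log L := mul_pos (by nlinarith) (by linarith)
  have hy1 : 1 ≤ x * Real.log x := by nlinarith
  have hlogy : 0 ≤ Real.log (x * Real.log x) := Real.log_nonneg hy1
  rw [← hx]
  obtain ⟨δ, hδ⟩ : ∃ δ, δ = √(Real.log (x * Real.log x) / x) := ⟨_, rfl⟩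
  rw [← hδ]
  have hδ0 : 0 ≤ δ := hδ ▸ Real.sqrt_nonneg _
  have hδ1 : δ ≤ 1 := by
    rw [hδ, Real.sqrt_le_iff, one_pow, div_le_one hx0]
    exact ⟨zero_le_one, (log_mul_log_le hx1).trans (two_mul_log_le hx0)⟩
  have hxδ : x * δ ^ 2 = Real.log (x * Real.log x) := by
    rw [hδ, Real.sq_sqrt (div_nonneg hlogy hx0.le), mul_div_cancel₀ _ hx0.ne']
  obtain ⟨R, hR⟩ : ∃ R, R = E * L * (1 - δ) + E := ⟨_, rfl⟩
  have hR0 : 0 ≤ R := by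
    rw [hR]
    have := mul_nonneg (mul_nonneg hE0.le (by linarith : 0 ≤ L)) (sub_nonneg.2 hδ1)
    linarith
  have hRle : R ≤ 2 * (E * L) := by
    rw [hR]
    have : 0 ≤ E * L * δ := mul_nonneg (mul_nonneg hE0.le (by linarith)) hδ0
    nlinarith
  have hmain := blockCapacity_ge_rate hE0 hE1 hL (by linarith) hδ0 hδ1 hR (by linarith)
    (Nat.cast_pos.1 hN0).ne' (by rwa [← le_div_iff₀ (by positivity), one_div])
  rw [← hx, hxδ] at hmain
  have hexp : Real.exp (4 - Real.log (x * Real.log x) / 2) ≤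
      Real.exp 4 / (L * √(Real.log L)) := by
    rw [Real.exp_sub]
    refine div_le_div_of_nonneg_left (Real.exp_nonneg 4)
      (mul_pos (by linarith) (Real.sqrt_pos.2 (by linarith))) ?_
    rw [← Real.log_sqrt (by linarith), Real.exp_log (Real.sqrt_pos.2 (by linarith))]
    refine le_trans (le_of_eq ?_) (Real.sqrt_le_sqrt hy)
    rw [Real.sqrt_mul (sq_nonneg L), Real.sqrt_sq (by linarith)]
  have herr : 2 * Real.exp (4 - Real.log (x * Real.log x) / 2) * R ≤
      4 * Real.exp 4 / √(Real.log L) * E := by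
    have h1 := mul_le_mul hexp hRle hR0
      (div_nonneg (Real.exp_nonneg 4) (mul_nonneg (by linarith) (Real.sqrt_nonneg _)))
    have hL0 : L ≠ 0 := by linarith
    have hs0 : √(Real.log L) ≠ 0 := (Real.sqrt_pos.2 (by linarith)).ne'
    have h2 : Real.exp 4 / (L * √(Real.log L)) * (2 * (E * L)) =
        2 * Real.exp 4 / √(Real.log L) * E := by
      field_simp
    rw [h2] at h1
    calc _ = 2 * (Real.exp (4 - Real.log (x * Real.log x) / 2) * R) := by ring
      _ ≤ 2 * (2 * Real.exp 4 / √(Real.log L) * E) := by linarith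
      _ = _ := by ring
  have h3 : 3 / N ≤ 3 / L ^ 2 * E := by
    rw [div_mul_eq_mul_div, div_le_div_iff₀ hN0 (by nlinarith)]
    nlinarith
  rw [le_div_iff₀ hN0]
  have h4 : 3 / (N : ℝ) * N = 3 := div_mul_cancel₀ _ hN0.ne'
  refine le_trans ?_ hmain
  rw [← hR]
  nlinarith [mul_le_mul_of_nonneg_right herr hN0.le, mul_le_mul_of_nonneg_right h3 hN0.le]

/-- Here `N E` is about `L² ℓ²` with `ℓ = log L`, so `δ` is of order `1 / (L √ℓ)` and the penalty `E
L δ` is of order `E / √ℓ`. -/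
theorem blockCapacity_lower_bound_at :
    ∃ r : ℝ → ℝ, r =o[𝓝[>] 0] (fun E : ℝ => E) ∧
      ∀ᶠ E : ℝ in 𝓝[>] 0, ∀ N : ℕ,
        |(N : ℝ) - E⁻¹ * Real.log (1 / E) ^ 2 * Real.log (Real.log (1 / E)) ^ 2| < 1 →
        E * Real.log (1 / E) + E + r E ≤ BPSK.blockCapacity (BPSK.bpsk E) N / N := by
  obtain ⟨r, hr, h⟩ := blockCapacity_lower_bound
  refine ⟨fun E => r E - 5 / √(Real.log (Real.log (1 / E))) * E,
    hr.sub (isLittleO_mul_of_tendsto (tendsto_const_div_sqrt_log_log 5)), ?_⟩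
  have hloglog := (Real.tendsto_log_atTop.comp tendsto_log_one_div).eventually_ge_atTop (2 : ℝ)
  filter_upwards [h, self_mem_nhdsWithin, tendsto_log_one_div.eventually_ge_atTop 3, hloglog,
    (tendsto_mul_log_pow 4).eventually_le_const (by norm_num : (0 : ℝ) < 1 / 2)]
    with E hE hE0 hL3 hℓ2 hEL4 N hN
  have hE0 : (0 : ℝ) < E := hE0
  simp only [Function.comp_apply] at hℓ2
  have hN' := abs_lt.1 hN
  specialize hE N
  obtain ⟨L, hL⟩ : ∃ L, L = Real.log (1 / E) := ⟨_, rfl⟩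
  rw [← hL] at hL3 hEL4 hE hℓ2 hN' ⊢
  obtain ⟨ℓ, hℓ⟩ : ∃ ℓ, ℓ = Real.log L := ⟨_, rfl⟩
  rw [← hℓ] at hℓ2 hN' ⊢
  have hℓL : ℓ ≤ L := hℓ ▸ Real.log_le_self (by linarith)
  have hL4 : 1 ≤ L ^ 4 := one_le_pow₀ (by linarith)
  have hE2 : E ≤ 1 / 2 := (le_mul_of_one_le_right hE0.le hL4).trans hEL4
  obtain ⟨x, hx⟩ : ∃ x, x = N * E := ⟨_, rfl⟩
  have hc : E⁻¹ * L ^ 2 * ℓ ^ 2 * E = L ^ 2 * ℓ ^ 2 := by field_simp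
  have hx1 : L ^ 2 * ℓ ^ 2 - E ≤ x := by
    rw [hx]
    nlinarith [mul_le_mul_of_nonneg_right hN'.1.le hE0.le]
  have hx2 : x ≤ L ^ 2 * ℓ ^ 2 + E := by
    rw [hx]
    nlinarith [mul_le_mul_of_nonneg_right hN'.2.le hE0.le]
  have hL2 : 9 ≤ L ^ 2 := by nlinarith
  have hℓ4 : 4 ≤ ℓ ^ 2 := by nlinarith
  have hℓL2 : ℓ ^ 2 ≤ L ^ 2 := pow_le_pow_left₀ (by linarith) hℓL 2
  have hprod : L ^ 2 * 4 ≤ L ^ 2 * ℓ ^ 2 := mul_le_mul_of_nonneg_left hℓ4 (by positivity)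
  have hxL : L ^ 2 ≤ x := by linarith
  have hxhalf : L ^ 2 * ℓ ^ 2 / 2 ≤ x := by linarith
  have hx0 : 0 < x := by linarith
  have hL4' : L ^ 2 * ℓ ^ 2 ≤ L ^ 4 := by
    have h1 : L ^ 2 * ℓ ^ 2 ≤ L ^ 2 * L ^ 2 := mul_le_mul_of_nonneg_left hℓL2 (by positivity)
    linarith [show L ^ 2 * L ^ 2 = L ^ 4 by ring]
  have hxL6 : x ≤ L ^ 6 := by
    have h1 : L ^ 4 * 9 ≤ L ^ 4 * L ^ 2 := mul_le_mul_of_nonneg_left hL2 (by positivity)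
    linarith [show L ^ 4 * L ^ 2 = L ^ 6 by ring]
  have hN1 : E⁻¹ * L ^ 2 ≤ N := by
    rw [inv_mul_le_iff₀ hE0, mul_comm, ← hx]
    exact hxL
  have hN2 : (N : ℝ) ≤ (E ^ 2)⁻¹ := by
    rw [← one_div, le_div_iff₀ (by positivity)]
    have h1 : (N : ℝ) * E ^ 2 = x * E := by rw [hx]; ring
    rw [h1]
    have h2 := mul_le_mul_of_nonneg_right hx2 hE0.le
    have h3 := mul_le_mul_of_nonneg_right hL4' hE0.le
    have h4 := mul_le_mul_of_nonneg_right hE2 hE0.le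
    linarith
  have hmain := hE hN1 hN2
  rw [← hx] at hmain
  have hs : 0 < √ℓ := Real.sqrt_pos.2 (by linarith)
  -- `log (x log x) ≤ 2 log x`, and `x ≤ L ^ 6` gives `log x ≤ 6 ℓ`.
  have hlogx : Real.log (x * Real.log x) ≤ 12 * ℓ := by
    refine (log_mul_log_le (by linarith)).trans ?_
    have h1 := Real.log_le_log hx0 hxL6
    rw [Real.log_pow, ← hℓ] at h1
    push_cast at h1
    linarith
  -- Dividing `12 ℓ` by `x ≥ L² ℓ² / 2` gives `24 / (L² ℓ)`, and `24 ≤ 5²`.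
  have hsqrt : √(Real.log (x * Real.log x) / x) ≤ 5 / (L * √ℓ) := by
    refine Real.sqrt_le_iff.2 ⟨div_nonneg (by norm_num) (mul_nonneg (by linarith) hs.le), ?_⟩
    have h1 : 0 < L ^ 2 * ℓ := mul_pos (by linarith) (by linarith)
    rw [div_pow, mul_pow, Real.sq_sqrt (by linarith), div_le_div_iff₀ hx0 h1]
    have h2 := mul_le_mul_of_nonneg_right hlogx h1.le
    have h3 : 12 * ℓ * (L ^ 2 * ℓ) = 24 * (L ^ 2 * ℓ ^ 2 / 2) := by ring
    linarith
  have h1 : E * L * √(Real.log (x * Real.log x) / x) ≤ 5 / √ℓ * E := by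
    have h2 := mul_le_mul_of_nonneg_left hsqrt (mul_nonneg hE0.le (by linarith : 0 ≤ L))
    have h3 : E * L * (5 / (L * √ℓ)) = 5 / √ℓ * E := by
      have : L ≠ 0 := by linarith
      field_simp
    rwa [h3] at h2
  linarith

/-! ### The capacity -/

/-- On a spectrum inside `{0, μ, ν}` the entropy function can be replaced by a quadratic without
constant term, so the functional calculus becomes `α ρ + β ρ²`, whose trace is elementary. The value
at 1 enters when one eigenvalue vanishes. -/
theorem exists_quadratic_interpolation (f : ℝ → ℝ) (h0 : f 0 = 0) (h1 : f 1 = 0) {μ ν : ℝ}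
    (hsum : μ + ν = 1) :
    ∃ α β : ℝ, f μ = α * μ + β * μ ^ 2 ∧ f ν = α * ν + β * ν ^ 2 := by
  by_cases hμ : μ = 0
  · obtain rfl : ν = 1 := by linarith
    exact ⟨0, 0, by simp [hμ, h0], by simp [h1]⟩
  by_cases hν : ν = 0
  · obtain rfl : μ = 1 := by linarith
    exact ⟨0, 0, by simp [h1], by simp [hν, h0]⟩
  by_cases hμν : μ = ν
  · subst hμν
    have : f μ = f μ / μ * μ + 0 * μ ^ 2 := by field_simp; ring
    exact ⟨f μ / μ, 0, this, this⟩
  · have hd : μ - ν ≠ 0 := sub_ne_zero.2 hμν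
    refine ⟨f μ / μ - (f μ / μ - f ν / ν) / (μ - ν) * μ, (f μ / μ - f ν / ν) / (μ - ν), ?_, ?_⟩
    · field_simp; ring
    · field_simp; ring

theorem hasSum_inner_rankOne {H : Type*} [NormedAddCommGroup H] [InnerProductSpace ℂ H]
    {ι : Type*} (e : HilbertBasis ι ℂ H) (u v : H) :
    HasSum (fun i => inner ℂ (e i) (InnerProductSpace.rankOne ℂ u v (e i))) (inner ℂ v u) := by
  refine (e.hasSum_inner_mul_inner v u).congr_fun fun i => ?_
  rw [InnerProductSpace.rankOne_apply, inner_smul_right]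

theorem isSelfAdjoint_densityOperator {H : Type*} [NormedAddCommGroup H] [InnerProductSpace ℂ H]
    [CompleteSpace H] {X : Type*} [Fintype X] (ψ : X → H) (p : X → ℝ) :
    IsSelfAdjoint (densityOperator ψ p) := by
  refine isSelfAdjoint_sum _ fun x _ => IsSelfAdjoint.smul ?_ ?_
  · exact Complex.conj_ofReal _
  · exact (InnerProductSpace.isPositive_rankOne_self (𝕜 := ℂ) (ψ x)).isSelfAdjoint

theorem densityOperator_bool_apply {H : Type*} [NormedAddCommGroup H] [InnerProductSpace ℂ H]
    (ψ : Bool → H) (p : Bool → ℝ) (φ : H) :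
    densityOperator ψ p φ = ((p true : ℂ) * inner ℂ (ψ true) φ) • ψ true +
      ((p false : ℂ) * inner ℂ (ψ false) φ) • ψ false := by
  simp [densityOperator, mul_smul]

/-- Entropy of a mixture of two pure states: the nonzero eigenvalues `μ`, `ν` are determined by
the trace and the determinant. -/
theorem vonNeumannEntropy_two_state {H : Type*} [NormedAddCommGroup H] [InnerProductSpace ℂ H]
    [CompleteSpace H] {ι : Type*} (e : HilbertBasis ι ℂ H) (ψ : Bool → H)
    (p : Bool → ℝ) (hp : p true + p false = 1) (c : ℝ)
    (hψ : ∀ x y, inner ℂ (ψ x) (ψ y) = if x = y then 1 else (c : ℂ)) {μ ν : ℝ}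
    (hsum : μ + ν = 1) (hprod : μ * ν = p true * p false * (1 - c ^ 2)) :
    vonNeumannEntropy e (densityOperator ψ p) = Real.binEntropy ν := by
  set ρ := densityOperator ψ p with hρ
  set u := ψ true with hu
  set v := ψ false with hv
  obtain ⟨a, ha⟩ : ∃ a, a = p true := ⟨_, rfl⟩
  have hb : p false = 1 - a := by linarith
  have huu : inner ℂ u u = (1 : ℂ) := by rw [hu, hψ, if_pos rfl]
  have hvv : inner ℂ v v = (1 : ℂ) := by rw [hv, hψ, if_pos rfl]
  have huv : inner ℂ u v = (c : ℂ) := by rw [hu, hv, hψ, if_neg (by decide)]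
  have hvu : inner ℂ v u = (c : ℂ) := by rw [hu, hv, hψ, if_neg (by decide)]
  have hap : ∀ φ, ρ φ = ((a : ℂ) * inner ℂ u φ) • u + ((1 - a : ℂ) * inner ℂ v φ) • v := fun φ => by
    rw [hρ, densityOperator_bool_apply, hb, ← ha]
    push_cast
    rfl
  have hlin : ∀ s t : ℂ, ρ (s • u + t • v) =
      (a * (s + c * t)) • u + ((1 - a) * (c * s + t)) • v := fun s t => by
    rw [hap]
    simp only [inner_add_right, inner_smul_right, huu, hvv, huv, hvu]
    module
  rw [← ha, hb] at hprod
  -- Cayley–Hamilton on the span of `u` and `v`, which contains the range of `ρ`; the trace is 1 and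
  -- the determinant `a (1 - a) (1 - c²)`.
  have hchar : ∀ φ, ρ (ρ (ρ φ)) - ρ (ρ φ) + ((a * (1 - a) * (1 - c ^ 2) : ℝ) : ℂ) • ρ φ = 0 :=
    fun φ => by
      rw [hap φ, hlin, hlin]
      push_cast
      module
  have hcub : ρ ^ 3 - ρ ^ 2 + (μ * ν) • ρ = 0 := by
    ext φ
    rw [hprod]
    exact hchar φ
  have hspec : ∀ t ∈ spectrum ℝ ρ, t = 0 ∨ t = μ ∨ t = ν := fun t ht => by
    have h1 := spectrum.subset_polynomial_aeval ρ
      (Polynomial.X ^ 3 - Polynomial.X ^ 2 + Polynomial.C (μ * ν) * Polynomial.X)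
      ⟨t, ht, rfl⟩
    have h2 : Polynomial.aeval ρ
        (Polynomial.X ^ 3 - Polynomial.X ^ 2 + Polynomial.C (μ * ν) * Polynomial.X) = 0 := by
      rw [← hcub]
      simp [Algebra.smul_def]
    have : Nontrivial H := ⟨u, 0, fun h => by simp [h] at huu⟩
    rw [h2, spectrum.zero_eq, Set.mem_singleton_iff] at h1
    simp only [Polynomial.eval_add, Polynomial.eval_sub, Polynomial.eval_pow, Polynomial.eval_mul,
      Polynomial.eval_X, Polynomial.eval_C] at h1
    have h3 : t * ((t - μ) * (t - ν)) = 0 := by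
      linear_combination h1 - t ^ 2 * hsum
    rcases mul_eq_zero.1 h3 with h | h
    · exact Or.inl h
    · rcases mul_eq_zero.1 h with h | h
      · exact Or.inr (Or.inl (by linarith))
      · exact Or.inr (Or.inr (by linarith))
  obtain ⟨α, β, hμ, hν⟩ := exists_quadratic_interpolation Real.negMulLog Real.negMulLog_zero
    Real.negMulLog_one hsum
  have hsa : IsSelfAdjoint ρ := isSelfAdjoint_densityOperator ψ p
  have hcfc : cfc Real.negMulLog ρ = α • ρ + β • ρ ^ 2 := by
    have h1 : cfc Real.negMulLog ρ = cfc (fun t : ℝ => α * t + β * t ^ 2) ρ := by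
      refine cfc_congr fun t ht => ?_
      rcases hspec t ht with rfl | rfl | rfl
      · simp
      · exact hμ
      · exact hν
    rw [h1, cfc_add (a := ρ) (fun t : ℝ => α * t) (fun t : ℝ => β * t ^ 2),
      cfc_const_mul_id α ρ, cfc_const_mul β (fun t : ℝ => t ^ 2) ρ, cfc_pow_id ρ 2]
  let R := fun x y : H => InnerProductSpace.rankOne ℂ x y
  have happ : ∀ i, inner ℂ (e i) (cfc Real.negMulLog ρ (e i)) =
      (α * a + β * a ^ 2 : ℂ) * inner ℂ (e i) (R u u (e i)) +
      (α * (1 - a) + β * (1 - a) ^ 2 : ℂ) * inner ℂ (e i) (R v v (e i)) +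
      (β * a * (1 - a) * c : ℂ) *
        (inner ℂ (e i) (R u v (e i)) + inner ℂ (e i) (R v u (e i))) := fun i => by
    have h1 : (α • ρ + β • ρ ^ 2) (e i) = (α : ℂ) • ρ (e i) + (β : ℂ) • ρ (ρ (e i)) := rfl
    rw [hcfc, h1, hap (e i), hlin]
    simp only [R, InnerProductSpace.rankOne_apply, inner_add_right, inner_smul_right]
    ring
  have htr := (((hasSum_inner_rankOne e u u).mul_left (α * a + β * a ^ 2 : ℂ)).add
    ((hasSum_inner_rankOne e v v).mul_left (α * (1 - a) + β * (1 - a) ^ 2 : ℂ))).add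
    (((hasSum_inner_rankOne e u v).add (hasSum_inner_rankOne e v u)).mul_left
      (β * a * (1 - a) * c : ℂ))
  have htr' := htr.congr_fun happ
  rw [huu, hvv, huv, hvu] at htr'
  have hre := (Complex.hasSum_re htr').tsum_eq
  rw [vonNeumannEntropy, hre, Real.binEntropy_eq_negMulLog_add_negMulLog_one_sub,
    show 1 - ν = μ by linarith, hμ, hν]
  have h5 : ((α * a + β * a ^ 2 : ℂ) * 1 + (α * (1 - a) + β * (1 - a) ^ 2) * 1 +
      β * a * (1 - a) * c * (c + c)) =
      ((α * a + β * a ^ 2 + (α * (1 - a) + β * (1 - a) ^ 2) +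
      β * a * (1 - a) * c * (c + c) : ℝ) : ℂ) := by
    push_cast
    ring
  rw [h5, Complex.ofReal_re]
  obtain rfl : μ = 1 - ν := by linarith
  -- This is `Tr ρ² = 1 - 2 a (1 - a) (1 - c²) = μ² + ν²`.
  linear_combination 2 * β * hprod

theorem inner_bpsk {E : ℝ} (hE : 0 ≤ E) (x y : Bool) :
    inner ℂ (bpsk E x) (bpsk E y) = if x = y then 1 else ((Real.exp (-(2 * E)) : ℝ) : ℂ) := by
  have hsym : Function.Surjective symbol := by decide
  obtain ⟨a, rfl⟩ := hsym x
  obtain ⟨b, rfl⟩ := hsym y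
  have h := lp.hasSum_inner (𝕜 := ℂ) (bpsk E (symbol a)) (bpsk E (symbol b))
  have h1 : ∀ n, inner ℂ (bpsk E (symbol a) n) (bpsk E (symbol b) n) =
      ((sgn ((a + b) * n) * amp E n ^ 2 : ℝ) : ℂ) := fun n => by
    rw [bpsk_apply hE, bpsk_apply hE, RCLike.inner_apply, Complex.conj_ofReal,
      ← Complex.ofReal_mul, add_mul, sgn_add]
    congr 1
    ring
  have h2 := h.congr_fun fun n => (h1 n).symm
  by_cases hab : a = b
  · subst hab
    rw [if_pos rfl]
    refine h2.unique ?_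
    have h3 := Complex.hasSum_ofReal.2 (hasSum_amp_sq hE)
    rw [Complex.ofReal_one] at h3
    simpa only [CharTwo.add_self_eq_zero, zero_mul, sgn_zero, one_mul] using h3
  · have hne : ∀ a b : ZMod 2, a ≠ b → a + b = 1 ∧ symbol a ≠ symbol b := by decide
    obtain ⟨hab1, hab2⟩ := hne a b hab
    rw [if_neg hab2]
    refine h2.unique ?_
    have h3 := Complex.hasSum_ofReal.2 (hasSum_neg_one_pow_mul_amp_sq hE)
    simpa only [hab1, one_mul, sgn_natCast] using h3

/-- The smaller eigenvalue is `(1 - √D) / 2` with `D = 1 - 4 p q (1 - c²)`. It is largest when `p q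
= 1/4`, where `√D = c`, and the binary entropy increases on `[0, 1/2]`. -/
theorem capacity_bpsk {E : ℝ} (hE : 0 ≤ E) :
    capacity (bpsk E) = Real.binEntropy (lam E 1) := by
  obtain ⟨c, hc⟩ : ∃ c, c = Real.exp (-(2 * E)) := ⟨_, rfl⟩
  have hc0 : 0 < c := hc ▸ Real.exp_pos _
  have hc1 : c ≤ 1 := by
    rw [hc, Real.exp_le_one_iff]
    linarith
  have hψ := inner_bpsk hE
  rw [← hc] at hψ
  have hlam : lam E 1 = (1 - c) / 2 := by
    rw [lam, sgn_one, hc]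
    ring
  rw [hlam]
  refine IsGreatest.csSup_eq ⟨⟨fun _ => 1 / 2, ⟨fun _ => by norm_num, by simp⟩, ?_⟩, ?_⟩
  · exact vonNeumannEntropy_two_state numberBasis (bpsk E) _ (by norm_num) c hψ
      (μ := (1 + c) / 2) (by ring) (by ring)
  · rintro _ ⟨p, hp, rfl⟩
    have hp1 : p true + p false = 1 := by simpa using hp.2
    have hab : p true * p false ≤ 1 / 4 := by nlinarith [sq_nonneg (p true - p false)]
    have hab0 : 0 ≤ p true * p false := mul_nonneg (hp.1 _) (hp.1 _)
    have hc2 : 0 ≤ 1 - c ^ 2 := by nlinarith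
    obtain ⟨D, hD⟩ : ∃ D, D = 1 - 4 * (p true * p false * (1 - c ^ 2)) := ⟨_, rfl⟩
    have hDc : c ^ 2 ≤ D := by nlinarith
    have hD1 : D ≤ 1 := by nlinarith
    have hD0 : 0 ≤ D := (sq_nonneg c).trans hDc
    have hsq := Real.sq_sqrt hD0
    have h1 : c ≤ √D := Real.le_sqrt_of_sq_le hDc
    have h2 : √D ≤ 1 := Real.sqrt_le_iff.2 ⟨zero_le_one, by rwa [one_pow]⟩
    change vonNeumannEntropy numberBasis (densityOperator (bpsk E) p) ≤ _
    rw [vonNeumannEntropy_two_state numberBasis (bpsk E) p hp1 c hψ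
      (μ := (1 + √D) / 2) (ν := (1 - √D) / 2) (by ring) (by linarith)]
    refine Real.binEntropy_strictMonoOn.monotoneOn ⟨?_, ?_⟩ ⟨?_, ?_⟩ ?_ <;> linarith

/-- With `l = lam E 1` and `E - E² ≤ l ≤ E`, the term `-l log l` lies between `l L` and `l L + E -
l`, and `-(1 - l) log (1 - l)` between `l - l²` and `l`. The total deviation is at most `E² L + 2
E²`. -/
theorem capacity_bpsk_asymptotic :
    (fun E : ℝ => capacity (bpsk E) - (E * Real.log (1 / E) + E))
      =o[𝓝[>] 0] (fun E : ℝ => E) := by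
  have hlim : Tendsto (fun E : ℝ => E * Real.log (1 / E) ^ 1 + 2 * E) (𝓝[>] 0) (𝓝 0) := by
    have h1 : Tendsto (fun E : ℝ => 2 * E) (𝓝[>] 0) (𝓝 0) := by
      have : Tendsto (fun E : ℝ => 2 * E) (𝓝 0) (𝓝 (2 * 0)) := tendsto_id.const_mul 2
      rw [mul_zero] at this
      exact this.mono_left nhdsWithin_le_nhds
    simpa using (tendsto_mul_log_pow 1).add h1
  refine IsBigO.trans_isLittleO (IsBigO.of_bound 1 ?_) (isLittleO_mul_of_tendsto hlim)
  filter_upwards [self_mem_nhdsWithin, tendsto_log_one_div.eventually_ge_atTop 1,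
    (tendsto_mul_log_pow 1).eventually_le_const (by norm_num : (0 : ℝ) < 1 / 2)]
    with E hE hL1 hEL
  have hE0 : (0 : ℝ) < E := hE
  rw [one_mul, Real.norm_eq_abs, Real.norm_eq_abs, capacity_bpsk hE0.le, pow_one]
  rw [pow_one] at hEL
  obtain ⟨L, hL⟩ : ∃ L, L = Real.log (1 / E) := ⟨_, rfl⟩
  rw [← hL] at hL1 hEL ⊢
  have hE2 : E ≤ 1 / 2 := (le_mul_of_one_le_right hE0.le hL1).trans hEL
  have hl0 := lam_pos hE0 1
  have hl1 := lam_one_le E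
  have hl2 := le_lam_one hE0.le
  obtain ⟨l, hl⟩ : ∃ l, l = lam E 1 := ⟨_, rfl⟩
  rw [← hl] at hl0 hl1 hl2 ⊢
  have hlogE : Real.log E = -L := by rw [hL, one_div, Real.log_inv, neg_neg]
  have h1 : Real.log l ≤ -L := hlogE ▸ Real.log_le_log hl0 hl1
  have h2 : -L - Real.log l ≤ E / l - 1 := by
    have := Real.log_le_sub_one_of_pos (div_pos hE0 hl0)
    rwa [Real.log_div hE0.ne' hl0.ne', hlogE] at this
  have h2' : l * (-L - Real.log l) ≤ E - l := by
    have := mul_le_mul_of_nonneg_left h2 hl0.le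
    rwa [mul_sub l (E / l), mul_one, mul_div_cancel₀ _ hl0.ne'] at this
  have h1l : 0 < 1 - l := by linarith
  have h3 := Real.log_le_sub_one_of_pos h1l
  have h4 := Real.one_sub_inv_le_log_of_pos h1l
  have h4' : (1 - l) - 1 ≤ (1 - l) * Real.log (1 - l) := by
    have := mul_le_mul_of_nonneg_left h4 h1l.le
    rwa [mul_sub, mul_one, mul_inv_cancel₀ h1l.ne'] at this
  have h3' := mul_le_mul_of_nonneg_left h3 h1l.le
  have hbin : Real.binEntropy l = -(l * Real.log l) - (1 - l) * Real.log (1 - l) := by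
    rw [Real.binEntropy, Real.log_inv, Real.log_inv]
    ring
  have h5 : 0 ≤ l * (-L - Real.log l) := mul_nonneg hl0.le (by linarith)
  have h6 : (E - l) * L ≤ E ^ 2 * L := mul_le_mul_of_nonneg_right (by linarith) (by linarith)
  have h7 : 0 ≤ (E - l) * L := mul_nonneg (by linarith) (by linarith)
  have h8 : l ^ 2 ≤ E ^ 2 := pow_le_pow_left₀ hl0.le hl1 2
  rw [hbin]
  refine le_trans (abs_le.2 ⟨?_, ?_⟩) (le_abs_self ((E * L + 2 * E) * E))
  · linarith
  · have h9 : 0 ≤ E ^ 2 * L := by positivity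
    linarith [sq_nonneg E]

end BPSK

theorem mainTheorem5 :
    (∃ r : ℝ → ℝ, r =o[𝓝[>] 0] (fun E : ℝ => E) ∧
      ∀ᶠ E : ℝ in 𝓝[>] 0, ∀ N : ℕ,
        E⁻¹ * Real.log (1 / E) ^ 2 ≤ N → (N : ℝ) ≤ (E ^ 2)⁻¹ →
        E * Real.log (1 / E) * (1 - Real.sqrt (Real.log (N * E * Real.log (N * E)) / (N * E)))
            + E + r E
          ≤ BPSK.blockCapacity (BPSK.bpsk E) N / N) ∧
    (∃ r : ℝ → ℝ, r =o[𝓝[>] 0] (fun E : ℝ => E) ∧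
      ∀ᶠ E : ℝ in 𝓝[>] 0, ∀ N : ℕ,
        |(N : ℝ) - E⁻¹ * Real.log (1 / E) ^ 2 * Real.log (Real.log (1 / E)) ^ 2| < 1 →
        E * Real.log (1 / E) + E + r E ≤ BPSK.blockCapacity (BPSK.bpsk E) N / N) ∧
    (fun E : ℝ => BPSK.capacity (BPSK.bpsk E) - (E * Real.log (1 / E) + E))
      =o[𝓝[>] 0] (fun E : ℝ => E) :=
  ⟨BPSK.blockCapacity_lower_bound, BPSK.blockCapacity_lower_bound_at,
    BPSK.capacity_bpsk_asymptotic⟩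
end
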